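/- Let $P$ be an irreducible stochastic matrix on a finite set $S$ with stationary distribution $\pi$, let $f:S\to\mathbb R$, $a=\min_x f(x)$, $b=\max_x f(x)$, $S_b=\{x\in S: f(x)=b\}$ and $\pi(f)=\sum_x \pi(x)f(x)$. Assume that (1) the submatrix of $P$ with rows and columns in $S_b$ is irreducible (a $1\times1$ zero matrix does not count as irreducible), and (2) for every $x\in S\setminus S_b$ there is $y\in S_b$ with $P(x,y)>0$. For $\theta\in\mathbb R$ let $\tilde P_\theta(x,y)=P(x,y)e^{\theta f(y)}$, let $\rho(\theta)$ be the spectral radius of $\tilde P_\theta$, $\Lambda(\theta)=\log\rho(\theta)$, and let $u_\theta,v_\theta$ be the unique entrywise positive left and right eigenvectors of $\tilde P_\theta$ for the eigenvalue $\rho(\theta)$ with $\sum_x u_\theta(x)=1$ and $\sum_x u_\theta(x)v_\theta(x)=1$. Put \[ K_u=\sup_{\theta\ge0,\;x,y\in S}\frac{v_\theta(x)}{v_\theta(y)},\qquad L_u=\sup_{\theta\ge0,\;x,y\in S}\left|\frac{d}{d\theta}\frac{v_\theta(x)}{v_\theta(y)}\right|,\qquad \sigma_u^2=\sup_{\theta\ge0}\Lambda''(\theta).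 \] Then $\Lambda$ is twice continuously differentiable on $\mathbb R$, all the ratios $\theta\mapsto v_\theta(x)/v_\theta(y)$ are differentiable on $\mathbb R$, the three suprema $K_u$, $L_u$, $\sigma_u^2$ are finite, and $\sigma_u^2>0$ if $f$ is not constant. Moreover, for every initial distribution $q$ on $S$, every Markov chain $(X_k)_{k\ge0}$ with initial distribution $q$ and transition matrix $P$, every integer $n\ge1$ and every real $\mu\ge\pi(f)$, \[ \Pr_q\!\left(\frac1n\sum_{k=1}^n f(X_k)\ge\mu\right) \le K_u\exp\!\left(-n\,\frac{(\mu-\pi(f))^2}{2\sigma_u^2}\right) \le K_u\exp\!\left(-n\,\frac{2(\mu-\pi(f))^2}{(b-a+2K_uL_u)^2}\right). \] (If $f$ is constant, both denominators are $0$; the quotients are then read as $0$.) -/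

import Mathlib

open MeasureTheory

namespace TiltedChain

noncomputable section

/-- The spectral radius of a real square matrix: the largest modulus of a complex eigenvalue. -/
def specRad {S : Type*} [Fintype S] [DecidableEq S] (M : Matrix S S ℝ) : ℝ :=
  (spectralRadius ℂ (M.map (algebraMap ℝ ℂ))).toReal

/-- `u` and `v` are entrywise positive left and right eigenvectors of `M` for the eigenvalue
`specRad M`, normalized by `∑ u = 1` and `∑ u v = 1`. -/
structure IsPerronPair {S : Type*} [Fintype S] [DecidableEq S]
    (M : Matrix S S ℝ) (u v : S → ℝ) : Prop where
  left_pos : ∀ x, 0 < u x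
  right_pos : ∀ x, 0 < v x
  left_eigen : Matrix.vecMul u M = specRad M • u
  right_eigen : Matrix.mulVec M v = specRad M • v
  sum_left : ∑ x, u x = 1
  sum_left_right : ∑ x, u x * v x = 1

open Classical in
/-- The normalized right Perron-Frobenius eigenvector of `M`. For an irreducible matrix the pair
`(u, v)` exists and is unique; the value `0` is used only if there is no such pair. -/
def perronRight {S : Type*} [Fintype S] [DecidableEq S] (M : Matrix S S ℝ) : S → ℝ :=
  if h : ∃ v u : S → ℝ, IsPerronPair M u v then h.choose else 0

/-- The exponentially tilted matrix `P(x, y) exp(θ f(y))`. -/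
def tilt {S : Type*} (P : Matrix S S ℝ) (f : S → ℝ) (θ : ℝ) : Matrix S S ℝ :=
  Matrix.of fun x y => P x y * Real.exp (θ * f y)

/-- The log-Perron-Frobenius eigenvalue `Λ(θ)` of the tilted matrix. -/
def Lam {S : Type*} [Fintype S] [DecidableEq S] (P : Matrix S S ℝ) (f : S → ℝ) (θ : ℝ) : ℝ :=
  Real.log (specRad (tilt P f θ))

/-- The ratio `v_θ(x) / v_θ(y)` of entries of the right Perron-Frobenius eigenvector of the tilted
matrix. (It does not change if the tilted matrix is multiplied by a positive scalar.) -/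
def vRatio {S : Type*} [Fintype S] [DecidableEq S] (P : Matrix S S ℝ) (f : S → ℝ)
    (x y : S) (θ : ℝ) : ℝ :=
  perronRight (tilt P f θ) x / perronRight (tilt P f θ) y

/-- All the ratios `v_θ(x) / v_θ(y)` with `θ ≥ 0`. -/
def ratioSet {S : Type*} [Fintype S] [DecidableEq S] (P : Matrix S S ℝ) (f : S → ℝ) : Set ℝ :=
  {r | ∃ θ : ℝ, 0 ≤ θ ∧ ∃ x y : S, r = vRatio P f x y θ}

/-- All the absolute derivatives `|d/dθ (v_θ(x) / v_θ(y))|` with `θ ≥ 0`. -/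
def ratioDerivSet {S : Type*} [Fintype S] [DecidableEq S] (P : Matrix S S ℝ) (f : S → ℝ) :
    Set ℝ :=
  {r | ∃ θ : ℝ, 0 ≤ θ ∧ ∃ x y : S, r = |deriv (vRatio P f x y) θ|}

/-- All the second derivatives `Λ''(θ)` with `θ ≥ 0`. -/
def curvatureSet {S : Type*} [Fintype S] [DecidableEq S] (P : Matrix S S ℝ) (f : S → ℝ) :
    Set ℝ :=
  {r | ∃ θ : ℝ, 0 ≤ θ ∧ r = deriv (deriv (Lam P f)) θ}

/-- The constant `K_u(P, f)`. -/
def Ku {S : Type*} [Fintype S] [DecidableEq S] (P : Matrix S S ℝ) (f : S → ℝ) : ℝ :=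
  sSup (ratioSet P f)

/-- The constant `L_u(P, f)`. -/
def Lu {S : Type*} [Fintype S] [DecidableEq S] (P : Matrix S S ℝ) (f : S → ℝ) : ℝ :=
  sSup (ratioDerivSet P f)

/-- The variance proxy `σ_u²(P, f)`. -/
def sigmaSq {S : Type*} [Fintype S] [DecidableEq S] (P : Matrix S S ℝ) (f : S → ℝ) : ℝ :=
  sSup (curvatureSet P f)

/-- `X` is a Markov chain `X₀, X₁, …` on the finite set `S` with initial distribution `q` and
transition matrix `P` under the probability measure `ℙ`. -/
structure IsMarkovChain {S Ω : Type*} [MeasurableSpace Ω] (ℙ : Measure Ω)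
    (q : S → ℝ) (P : Matrix S S ℝ) (X : ℕ → Ω → S) : Prop where
  measurable : ∀ (k : ℕ) (s : S), MeasurableSet {ω | X k ω = s}
  law : ∀ (n : ℕ) (x : ℕ → S),
    ℙ.real {ω | ∀ k ≤ n, X k ω = x k} = q (x 0) * ∏ k ∈ Finset.range n, P (x k) (x (k + 1))

end

end TiltedChain

/-!
The moment generating function of `∑ f(X_k)` is a bilinear form in the `n`-th power of the tilted
matrix `P(x, y) exp(θ f(y))`. Dominating the constant function by the right Perron-Frobenius
eigenvector `v_θ` costs the factor `K_u` and turns that power into `exp(n Λ(θ))`, so Chernoff's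
method gives `K_u exp(n (Λ(θ) - θ μ))` for every `θ ≥ 0` (`chernoff`). Since `Λ(0) = 0`,
`Λ'(0) = π(f)` and `Λ'' ≤ σ_u²` on `[0, ∞)`, the choice `θ = (μ - π(f)) / σ_u²` yields the first
bound.

For the second bound consider the Doob transform (`twist`)
`P_θ(x, y) = P(x, y) exp(θ f(y)) v_θ(y) / (ρ(θ) v_θ(x))`, a stochastic matrix. Differentiating `∑_y P_θ(x, y) = 1` twice shows that its score
`f(y) - Λ'(θ) + h(y) - h(x)`, where `h = d/dθ log v_θ`, has conditional mean zero and that `Λ''(θ)`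
is the variance of the score under the stationary law of `P_θ` (`deriv2_Lam_eq`). The score lies in
an interval of length `b - a + 2 K_u L_u`, whence `σ_u² ≤ (b - a + 2 K_u L_u)² / 4` by Popoviciu's
inequality. If the variance vanished, so would the score on every edge; following edges between
maximizers of `f` from a minimum of `h` then forces `Λ'(θ) ≥ b`, hence `f = b` everywhere.

Perron-Frobenius theory is developed from scratch: existence by maximizing `r` in `A v ≥ r v`
(`exists_pos_eigenvector`), simplicity of the eigenvalue, identification with the spectral radius,
and smooth dependence on `θ` by the implicit function theorem (`contDiffAt_perron`).

That `K_u` and `L_u` are finite is a statement about `θ → ∞`. Relative to `ρ(θ)`, the tilted weights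
of the edges into the set of maximizers of `f` stay bounded below, so a Harnack inequality along
paths inside that set (`irreducible_harnack`) bounds the ratios of `v_θ` there uniformly in `θ`;
points outside are one step away from the set, and the weights of edges into them decay
(`exists_vRatio_le`). Consequently `P_θ` also charges the edges into the set of maximizers uniformly,
and the same argument bounds the oscillation of `h`, which solves a Poisson equation for `P_θ`
(`exists_logEigen_deriv_sub_le`).
-/

/-! ### Irreducible nonnegative matrices -/

namespace TiltedChain

section Perron

variable {T : Type*} {A : Matrix T T ℝ}

lemma irreducible_propagate (hA : A.IsIrreducible) {Q : T → Prop}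
    (h : ∀ x y, 0 < A x y → Q x → Q y) {x : T} (hx : Q x) (y : T) : Q y := by
  let : Quiver T := A.toQuiver
  obtain ⟨p, -⟩ := hA.connected x y
  induction p with
  | nil => exact hx
  | cons _ e ih => exact h _ _ e.down ih

lemma irreducible_exists_succ (hA : A.IsIrreducible) (x : T) : ∃ y, 0 < A x y := by
  let : Quiver T := A.toQuiver
  by_contra! hcon
  have key : ∀ y, ∀ p : Quiver.Path x y, p.length = 0 := by
    intro y p
    induction p with
    | nil => rfl
    | cons q e ih =>
      obtain rfl := Quiver.Path.eq_of_length_zero q ih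
      exact absurd e.down (not_lt.2 (hcon _))
  obtain ⟨p, hp⟩ := hA.connected x x
  exact hp.ne' (key x p)

/-- A Harnack inequality: if a nonnegative function grows at most by a factor `C` along each edge of
a finite strongly connected graph, then all its values are comparable, with a constant that depends
only on `C` and on the graph. -/
lemma irreducible_harnack [Finite T] (hA : A.IsIrreducible) {C : ℝ} (hC : 0 ≤ C) :
    ∃ K : ℝ, 0 ≤ K ∧ ∀ φ : T → ℝ, (∀ x, 0 ≤ φ x) → (∀ x y, 0 < A x y → φ y ≤ C * φ x) →
      ∀ x y, φ y ≤ K * φ x := by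
  have := Fintype.ofFinite T
  let : Quiver T := A.toQuiver
  choose p _ using hA.connected
  have key : ∀ φ : T → ℝ, (∀ x y, 0 < A x y → φ y ≤ C * φ x) →
      ∀ x y, ∀ q : Quiver.Path x y, φ y ≤ C ^ q.length * φ x := by
    intro φ h x y q
    induction q with
    | nil => simp
    | cons q e ih =>
      refine (h _ _ e.down).trans ?_
      rw [Quiver.Path.length_cons, pow_succ', mul_assoc]
      exact mul_le_mul_of_nonneg_left ih hC
  refine ⟨∑ x, ∑ y, C ^ (p x y).length, by positivity, fun φ hφ h x y => ?_⟩
  refine (key φ h x y (p x y)).trans (mul_le_mul_of_nonneg_right ?_ (hφ x))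
  calc C ^ (p x y).length ≤ ∑ y, C ^ (p x y).length :=
        Finset.single_le_sum (f := fun y => C ^ (p x y).length) (fun _ _ => by positivity)
          (Finset.mem_univ y)
    _ ≤ _ := Finset.single_le_sum (f := fun x => ∑ y, C ^ (p x y).length)
          (fun _ _ => by positivity) (Finset.mem_univ x)

variable [Fintype T]

lemma mulVec_apply_eq (A : Matrix T T ℝ) (v : T → ℝ) (x : T) :
    (A.mulVec v) x = ∑ y, A x y * v y := rfl

/-- A nonnegative eigenvector of an irreducible matrix vanishes identically as soon as it vanishes
at one point. -/
lemma eigenvector_eq_zero (hA : A.IsIrreducible) {r : ℝ} {v : T → ℝ}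
    (hv : ∀ x, 0 ≤ v x) (h : A.mulVec v = r • v) {x : T} (hx : v x = 0) : v = 0 := by
  funext y
  refine irreducible_propagate hA (Q := fun y => v y = 0) (fun a b hab ha => ?_) hx y
  have h0 : ∑ y, A a y * v y = 0 := by
    have := congrFun h a
    rw [mulVec_apply_eq] at this
    simpa [ha] using this
  have h1 := (Finset.sum_eq_zero_iff_of_nonneg
    (fun y _ => mul_nonneg (hA.nonneg a y) (hv y))).1 h0 b (Finset.mem_univ b)
  exact (mul_eq_zero.1 h1).resolve_left hab.ne'

lemma eigenvector_unique (hA : A.IsIrreducible) [Nonempty T] {r : ℝ} {v w : T → ℝ}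
    (hv : ∀ x, 0 < v x) (h : A.mulVec v = r • v) (hw : A.mulVec w = r • w) :
    ∃ c : ℝ, w = c • v := by
  obtain ⟨x, hx⟩ := Finite.exists_min fun x => w x / v x
  refine ⟨w x / v x, ?_⟩
  have := eigenvector_eq_zero hA (r := r) (v := w - (w x / v x) • v) (x := x) (fun y => ?_) ?_ ?_
  · exact sub_eq_zero.1 this
  · have := (le_div_iff₀ (hv y)).1 (hx y)
    simpa using this
  · rw [Matrix.mulVec_sub, Matrix.mulVec_smul, h, hw, smul_sub, smul_comm]
  · simp [(hv x).ne']

lemma exists_pos_power_sum [DecidableEq T] (hA : A.IsIrreducible) :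
    ∃ N : ℕ, ∀ x y, 0 < (∑ k ∈ Finset.range N, A ^ k) x y := by
  have h := (Matrix.isIrreducible_iff_exists_pow_pos hA.nonneg).1 hA
  choose k _ hk using h
  refine ⟨(∑ x, ∑ y, k x y) + 1, fun x y => ?_⟩
  rw [Matrix.sum_apply]
  refine Finset.sum_pos' (fun i _ => Matrix.pow_apply_nonneg hA.nonneg i x y)
    ⟨k x y, Finset.mem_range.2 (Nat.lt_succ_of_le ?_), hk x y⟩
  exact (Finset.single_le_sum (f := fun y => k x y) (fun _ _ => Nat.zero_le _)
    (Finset.mem_univ y)).trans (Finset.single_le_sum (f := fun x => ∑ y, k x y)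
      (fun _ _ => Nat.zero_le _) (Finset.mem_univ x))

lemma mulVec_pos_of_pos {B : Matrix T T ℝ} (hB : ∀ x y, 0 < B x y) {z : T → ℝ}
    (hz : ∀ x, 0 ≤ z x) {i : T} (hi : 0 < z i) (x : T) : 0 < B.mulVec z x :=
  Finset.sum_pos' (fun y _ => mul_nonneg (hB x y).le (hz y))
    ⟨i, Finset.mem_univ i, mul_pos (hB x i) hi⟩

/-- Existence of the Perron-Frobenius eigenvector. The eigenvalue is the largest `r` for which some
probability vector `v` satisfies `A v ≥ r v`; if such a `v` were not an eigenvector, applying to it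
a positive matrix that commutes with `A` would make the inequality strict and `r` could grow. -/
theorem exists_pos_eigenvector [Nonempty T] (hA : A.IsIrreducible) :
    ∃ r : ℝ, 0 < r ∧ ∃ v : T → ℝ, (∀ x, 0 < v x) ∧ A.mulVec v = r • v := by
  classical
  let F : Set (ℝ × (T → ℝ)) :=
    {q | ∀ i, q.1 * q.2 i ≤ A.mulVec q.2 i}
  have hF : IsClosed F := by
    simp only [F, Set.ofPred_forall, mulVec_apply_eq]
    refine isClosed_iInter fun i => isClosed_le (by fun_prop) (by fun_prop)
  let R : ℝ := ∑ i, ∑ j, A i j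
  have hR : 0 ≤ R := Finset.sum_nonneg fun i _ => Finset.sum_nonneg fun j _ => hA.nonneg i j
  have hcomp : IsCompact ((Set.Icc 0 R ×ˢ stdSimplex ℝ T) ∩ F) :=
    (isCompact_Icc.prod (isCompact_stdSimplex ℝ T)).inter_right hF
  have hbound : ∀ (r : ℝ) (x : T → ℝ), x ∈ stdSimplex ℝ T → (∀ i, r * x i ≤ A.mulVec x i) →
      r ≤ R := by
    intro r x hx h
    calc r = ∑ i, r * x i := by rw [← Finset.mul_sum, hx.2, mul_one]
      _ ≤ ∑ i, A.mulVec x i := Finset.sum_le_sum fun i _ => h i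
      _ ≤ R := Finset.sum_le_sum fun i _ => Finset.sum_le_sum fun j _ => by
          refine mul_le_of_le_one_right (hA.nonneg i j) ?_
          rw [← hx.2]
          exact Finset.single_le_sum (fun k _ => hx.1 k) (Finset.mem_univ j)
  have hne : ((Set.Icc 0 R ×ˢ stdSimplex ℝ T) ∩ F).Nonempty := by
    obtain ⟨i⟩ := ‹Nonempty T›
    refine ⟨(0, Pi.single i 1), ⟨⟨le_rfl, hR⟩, single_mem_stdSimplex ℝ i⟩, fun j => ?_⟩
    simp [hA.nonneg]
  obtain ⟨⟨r, v⟩, ⟨⟨⟨hr0, -⟩, hv⟩, hrv⟩, hmax⟩ :=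
    hcomp.exists_isMaxOn hne continuous_fst.continuousOn
  simp only at hr0 hv
  have hrv : ∀ i, r * v i ≤ A.mulVec v i := hrv
  obtain ⟨i₀, hi₀⟩ : ∃ i, 0 < v i := by
    by_contra! hcon
    have : ∑ i, v i ≤ 0 := Finset.sum_nonpos fun i _ => hcon i
    linarith [hv.2]
  have heig : A.mulVec v = r • v := by
    by_contra hcon
    obtain ⟨N, hN⟩ := exists_pos_power_sum hA
    set B := ∑ k ∈ Finset.range N, A ^ k with hB
    have hcomm : A * B = B * A := by
      rw [hB, Finset.mul_sum, Finset.sum_mul]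
      exact Finset.sum_congr rfl fun k _ => (pow_succ' A k).symm.trans (pow_succ A k)
    obtain ⟨i, hi⟩ := Function.ne_iff.1 hcon
    have hz : ∀ x, 0 < B.mulVec (A.mulVec v - r • v) x := by
      refine mulVec_pos_of_pos hN (fun x => by simpa using hrv x) (i := i) ?_
      have := lt_of_le_of_ne (hrv i) (Ne.symm hi)
      simpa using this
    have hy : ∀ x, 0 < B.mulVec v x := mulVec_pos_of_pos hN hv.1 hi₀
    set y := B.mulVec v
    have hAy : B.mulVec (A.mulVec v - r • v) = A.mulVec y - r • y := by
      simp only [y]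
      rw [Matrix.mulVec_sub, Matrix.mulVec_smul, Matrix.mulVec_mulVec, Matrix.mulVec_mulVec, hcomm]
    rw [hAy] at hz
    obtain ⟨j, hj⟩ := Finite.exists_min fun x => (A.mulVec y - r • y) x / y x
    set ε := (A.mulVec y - r • y) j / y j
    have hε : 0 < ε := div_pos (hz j) (hy j)
    have hs : 0 < ∑ x, y x := Finset.sum_pos (fun x _ => hy x) Finset.univ_nonempty
    have hmem : (∑ x, y x)⁻¹ • y ∈ stdSimplex ℝ T := by
      refine ⟨fun x => ?_, ?_⟩
      · exact mul_nonneg (inv_nonneg.2 hs.le) (hy x).le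
      · simp [← Finset.mul_sum, hs.ne']
    have hineq : ∀ i, (r + ε) * ((∑ x, y x)⁻¹ • y) i ≤ A.mulVec ((∑ x, y x)⁻¹ • y) i := by
      intro x
      have h1 := (le_div_iff₀ (hy x)).1 (hj x)
      have h2 : (r + ε) * y x ≤ A.mulVec y x := by
        simp only [Pi.sub_apply, Pi.smul_apply, smul_eq_mul] at h1
        linarith
      rw [Matrix.mulVec_smul]
      simp only [Pi.smul_apply, smul_eq_mul]
      have := mul_le_mul_of_nonneg_left h2 (inv_nonneg.2 hs.le)
      linarith
    have := hmax (a := (r + ε, (∑ x, y x)⁻¹ • y))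
      ⟨⟨⟨by positivity, hbound _ _ hmem hineq⟩, hmem⟩, hineq⟩
    simp only [Set.mem_ofPred_eq] at this
    linarith
  have hpos : ∀ x, 0 < v x := by
    intro x
    refine lt_of_le_of_ne (hv.1 x) fun hx => ?_
    rw [eigenvector_eq_zero hA hv.1 heig hx.symm] at hi₀
    exact lt_irrefl _ hi₀
  refine ⟨r, ?_, v, hpos, heig⟩
  obtain ⟨j, hj⟩ := irreducible_exists_succ hA i₀
  have h1 : 0 < A.mulVec v i₀ := Finset.sum_pos' (fun y _ => mul_nonneg (hA.nonneg i₀ y) (hv.1 y))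
    ⟨j, Finset.mem_univ j, mul_pos hj (hpos j)⟩
  rw [heig] at h1
  exact pos_of_mul_pos_left h1 (hpos i₀).le

lemma left_right_eigenvalue_eq [Nonempty T] {r s : ℝ} {u v : T → ℝ} (hu : ∀ x, 0 < u x)
    (hv : ∀ x, 0 < v x) (hul : A.vecMul u = s • u) (hvr : A.mulVec v = r • v) : s = r := by
  have h := Matrix.dotProduct_mulVec u A v
  rw [hvr, hul, dotProduct_smul, smul_dotProduct] at h
  have hpos : 0 < u ⬝ᵥ v := Finset.sum_pos (fun x _ => mul_pos (hu x) (hv x)) Finset.univ_nonempty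
  exact (mul_right_cancel₀ hpos.ne' h).symm

variable [DecidableEq T]

/-- A positive eigenvector of a nonnegative matrix belongs to the spectral radius: for any other
eigenpair `(μ, w)` compare `|w|` with the smallest multiple of `v` that dominates it. -/
lemma specRad_eq_of_pos_eigenvector [Nonempty T] (hA : ∀ x y, 0 ≤ A x y) {r : ℝ} {v : T → ℝ}
    (hr : 0 ≤ r) (hv : ∀ x, 0 < v x) (h : A.mulVec v = r • v) : specRad A = r := by
  set M : Matrix T T ℂ := A.map (algebraMap ℝ ℂ) with hM
  have hmem : ∀ μ : ℂ, μ ∈ spectrum ℂ M ↔ ∃ w : T → ℂ, w ≠ 0 ∧ M.mulVec w = μ • w := by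
    intro μ
    rw [← Matrix.spectrum_toLin', ← Module.End.hasEigenvalue_iff_mem_spectrum]
    constructor
    · intro hμ
      obtain ⟨w, hw⟩ := hμ.exists_hasEigenvector
      exact ⟨w, hw.2, by simpa using hw.apply_eq_smul⟩
    · rintro ⟨w, hw, h⟩
      exact Module.End.hasEigenvalue_of_hasEigenvector
        ⟨Module.End.mem_eigenspace_iff.2 (by simpa using h), hw⟩
  have hle : ∀ μ ∈ spectrum ℂ M, ‖μ‖ ≤ r := by
    intro μ hμ
    obtain ⟨w, hw, hMw⟩ := (hmem μ).1 hμ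
    obtain ⟨x, hx⟩ := Finite.exists_max fun x => ‖w x‖ / v x
    set t := ‖w x‖ / v x with ht
    have hwt : ∀ y, ‖w y‖ ≤ t * v y := fun y => (div_le_iff₀ (hv y)).1 (hx y)
    have hwx : ‖w x‖ = t * v x := by rw [ht, div_mul_cancel₀ _ (hv x).ne']
    have hwpos : 0 < ‖w x‖ := by
      obtain ⟨y, hy⟩ := Function.ne_iff.1 hw
      have h1 : 0 < ‖w y‖ := norm_pos_iff.2 hy
      have h2 : 0 < t := pos_of_mul_pos_left (h1.trans_le (hwt y)) (hv y).le
      rw [hwx]; exact mul_pos h2 (hv x)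
    have h1 : ‖μ‖ * ‖w x‖ ≤ r * ‖w x‖ := by
      have h2 : μ * w x = ∑ y, (A x y : ℂ) * w y := by
        have := congrFun hMw x
        simpa [Matrix.mulVec, dotProduct, hM] using this.symm
      rw [← norm_mul, h2]
      refine (norm_sum_le _ _).trans ?_
      have h3 : r * ‖w x‖ = ∑ y, A x y * (t * v y) := by
        have := congrFun h x
        rw [mulVec_apply_eq] at this
        simp only [Pi.smul_apply, smul_eq_mul] at this
        rw [hwx, mul_left_comm, ← this, Finset.mul_sum]
        exact Finset.sum_congr rfl fun y _ => by ring
      rw [h3]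
      refine Finset.sum_le_sum fun y _ => ?_
      rw [norm_mul, Complex.norm_real, Real.norm_of_nonneg (hA x y)]
      exact mul_le_mul_of_nonneg_left (hwt y) (hA x y)
    exact le_of_mul_le_mul_right h1 hwpos
  have hrmem : (r : ℂ) ∈ spectrum ℂ M := by
    refine (hmem r).2 ⟨fun x => (v x : ℂ), ?_, ?_⟩
    · obtain ⟨x⟩ := ‹Nonempty T›
      refine Function.ne_iff.2 ⟨x, ?_⟩
      simpa using (hv x).ne'
    · funext x
      have := congrFun h x
      rw [mulVec_apply_eq] at this
      simp only [Matrix.mulVec, dotProduct, hM, Matrix.map_apply, Pi.smul_apply, smul_eq_mul,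
        Complex.coe_algebraMap] at this ⊢
      exact_mod_cast this
  have hsr : spectralRadius ℂ M = ENNReal.ofReal r := by
    refine le_antisymm (iSup₂_le fun μ hμ => ?_) ?_
    · exact ENNReal.coe_le_coe.2 ((Real.le_toNNReal_iff_coe_le hr).2 (hle μ hμ))
    · refine le_iSup₂_of_le (r : ℂ) hrmem (ENNReal.coe_le_coe.2 (Real.toNNReal_le_iff_le_coe.2 ?_))
      simpa using le_abs_self r
  rw [specRad, hsr, ENNReal.toReal_ofReal hr]

theorem exists_isPerronPair [Nonempty T] (hA : A.IsIrreducible) :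
    0 < specRad A ∧ ∃ u v : T → ℝ, IsPerronPair A u v := by
  obtain ⟨r, hr, v, hv, hvr⟩ := exists_pos_eigenvector hA
  obtain ⟨s, hs, u, hu, hur⟩ := exists_pos_eigenvector hA.transpose
  rw [Matrix.mulVec_transpose] at hur
  have hsr := left_right_eigenvalue_eq hu hv hur hvr
  have hspec := specRad_eq_of_pos_eigenvector hA.nonneg hr.le hv hvr
  refine ⟨hspec ▸ hr, ?_⟩
  have hU : 0 < ∑ x, u x := Finset.sum_pos (fun x _ => hu x) Finset.univ_nonempty
  have hUV : 0 < ∑ x, u x * v x :=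
    Finset.sum_pos (fun x _ => mul_pos (hu x) (hv x)) Finset.univ_nonempty
  refine ⟨(∑ x, u x)⁻¹ • u, ((∑ x, u x) * (∑ x, u x * v x)⁻¹) • v, ?_, ?_, ?_, ?_, ?_, ?_⟩
  · intro x; exact mul_pos (inv_pos.2 hU) (hu x)
  · intro x; exact mul_pos (mul_pos hU (inv_pos.2 hUV)) (hv x)
  · rw [Matrix.smul_vecMul, hur, hspec, hsr, smul_comm]
  · rw [Matrix.mulVec_smul, hvr, hspec, smul_comm]
  · simp [← Finset.mul_sum, hU.ne']
  · have : ∀ x, ((∑ x, u x)⁻¹ • u) x * (((∑ x, u x) * (∑ x, u x * v x)⁻¹) • v) x =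
        (∑ x, u x * v x)⁻¹ * (u x * v x) := by
      intro x
      simp only [Pi.smul_apply, smul_eq_mul]
      field_simp
    simp_rw [this, ← Finset.mul_sum]
    exact inv_mul_cancel₀ hUV.ne'

lemma perronRight_spec [Nonempty T] (hA : A.IsIrreducible) :
    (∀ x, 0 < perronRight A x) ∧ A.mulVec (perronRight A) = specRad A • perronRight A := by
  obtain ⟨-, u, v, huv⟩ := exists_isPerronPair hA
  have h : ∃ v u : T → ℝ, IsPerronPair A u v := ⟨v, u, huv⟩
  rw [perronRight, dif_pos h]
  obtain ⟨u', hu'⟩ := h.choose_spec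
  exact ⟨hu'.right_pos, hu'.right_eigen⟩

end Perron

end TiltedChain

/-! ### Smooth dependence of the Perron-Frobenius data on the matrix -/

namespace TiltedChain

open scoped Topology ContDiff

section Smooth

variable {T : Type*} [Fintype T] [DecidableEq T]

/-- The right Perron-Frobenius eigenvector rescaled to total mass one. This normalization is linear
in the eigenvector alone, so that the implicit function theorem applies to it directly. -/
noncomputable def perronProb (A : Matrix T T ℝ) : T → ℝ :=
  fun x => perronRight A x / ∑ y, perronRight A y

variable [Nonempty T] {A : Matrix T T ℝ}

lemma sum_perronRight_pos (hA : A.IsIrreducible) : 0 < ∑ y, perronRight A y :=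
  Finset.sum_pos (fun x _ => (perronRight_spec hA).1 x) Finset.univ_nonempty

lemma perronProb_pos (hA : A.IsIrreducible) (x : T) : 0 < perronProb A x :=
  div_pos ((perronRight_spec hA).1 x) (sum_perronRight_pos hA)

lemma sum_perronProb (hA : A.IsIrreducible) : ∑ x, perronProb A x = 1 := by
  simp only [perronProb]
  rw [← Finset.sum_div, div_self (sum_perronRight_pos hA).ne']

lemma mulVec_perronProb (hA : A.IsIrreducible) :
    A.mulVec (perronProb A) = specRad A • perronProb A := by
  have h : perronProb A = (∑ y, perronRight A y)⁻¹ • perronRight A := by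
    funext x
    simp [perronProb, div_eq_inv_mul]
  rw [h, Matrix.mulVec_smul, (perronRight_spec hA).2, smul_comm]

lemma perronRight_div (hA : A.IsIrreducible) (x y : T) :
    perronRight A x / perronRight A y = perronProb A x / perronProb A y := by
  rw [perronProb, perronProb, div_div_div_cancel_right₀ (sum_perronRight_pos hA).ne']

lemma perron_unique (hA : A.IsIrreducible) {r : ℝ} {v : T → ℝ} (hr : 0 ≤ r)
    (hv : ∀ x, 0 < v x) (hs : ∑ x, v x = 1) (h : A.mulVec v = r • v) :
    specRad A = r ∧ perronProb A = v := by
  have hspec := specRad_eq_of_pos_eigenvector hA.nonneg hr hv h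
  refine ⟨hspec, ?_⟩
  have h2 := mulVec_perronProb hA
  rw [hspec] at h2
  obtain ⟨c, hc⟩ := eigenvector_unique hA hv h h2
  have h3 := sum_perronProb hA
  rw [hc] at h3
  simp only [Pi.smul_apply, smul_eq_mul, ← Finset.mul_sum, hs, mul_one] at h3
  rw [hc, h3, one_smul]

lemma exists_left_eigenvector (hA : A.IsIrreducible) :
    ∃ u : T → ℝ, (∀ x, 0 < u x) ∧ A.vecMul u = specRad A • u := by
  obtain ⟨-, u, v, huv⟩ := exists_isPerronPair hA
  exact ⟨u, huv.left_pos, huv.left_eigen⟩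

/-- The Perron-Frobenius eigenvalue and the normalized eigenvector are as smooth as the matrix. Near
`θ₀` they solve `M(θ) w = l w`, `∑ w = 1`; the partial derivative of this system in `(w, l)` is
injective because the eigenspace is a line and the left eigenvector is positive. -/
theorem contDiffAt_perron {n : ℕ∞ω} (hn : n ≠ 0) {M : ℝ → Matrix T T ℝ}
    (hM : ∀ x y, ContDiff ℝ n fun θ => M θ x y) (hirr : ∀ θ, (M θ).IsIrreducible) (θ₀ : ℝ) :
    ContDiffAt ℝ n (fun θ => specRad (M θ)) θ₀ ∧
      ∀ x, ContDiffAt ℝ n (fun θ => perronProb (M θ) x) θ₀ := by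
  set v := perronProb (M θ₀)
  set r := specRad (M θ₀)
  have hv : ∀ x, 0 < v x := perronProb_pos (hirr θ₀)
  have hr : 0 < r := (exists_isPerronPair (hirr θ₀)).1
  have hs : ∑ x, v x = 1 := sum_perronProb (hirr θ₀)
  have heig : (M θ₀).mulVec v = r • v := mulVec_perronProb (hirr θ₀)
  let F : ℝ × ((T → ℝ) × ℝ) → (T → ℝ) × ℝ := fun q =>
    ((M q.1).mulVec q.2.1 - q.2.2 • q.2.1, ∑ x, q.2.1 x)
  have hF : ContDiff ℝ n F := by
    refine ContDiff.prodMk ?_ (by fun_prop)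
    refine contDiff_pi.2 fun x => ?_
    simp only [Pi.sub_apply, mulVec_apply_eq, Pi.smul_apply, smul_eq_mul]
    have := fun y => (hM x y).comp (contDiff_fst (E := ℝ) (F := (T → ℝ) × ℝ))
    simp only [Function.comp_def] at this
    fun_prop
  let u : ℝ × ((T → ℝ) × ℝ) := (θ₀, (v, r))
  have hFu : F u = (0, 1) := by simp [F, u, heig, hs]
  let Lc : (T → ℝ) →L[ℝ] (T → ℝ) := (M θ₀).mulVecLin.toContinuousLinearMap
  let sumc : (T → ℝ) →L[ℝ] ℝ := ∑ x, ContinuousLinearMap.proj x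
  let G' : (T → ℝ) × ℝ →L[ℝ] (T → ℝ) × ℝ :=
    ((Lc.comp (.fst ℝ _ _)) - (r • (ContinuousLinearMap.fst ℝ (T → ℝ) ℝ) +
      (ContinuousLinearMap.snd ℝ (T → ℝ) ℝ).smulRight v)).prod
      (sumc.comp (.fst ℝ _ _))
  have hG : HasFDerivAt (fun q : (T → ℝ) × ℝ => F (θ₀, q)) G' (v, r) := by
    have h1 : HasFDerivAt (fun q : (T → ℝ) × ℝ => q.2 • q.1)
        (r • (ContinuousLinearMap.fst ℝ (T → ℝ) ℝ) +
          (ContinuousLinearMap.snd ℝ (T → ℝ) ℝ).smulRight v) (v, r) :=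
      (hasFDerivAt_snd (𝕜 := ℝ) (p := ((v, r) : (T → ℝ) × ℝ))).fun_smul hasFDerivAt_fst
    have h2 := ((Lc.comp (.fst ℝ _ ℝ)).hasFDerivAt (x := (v, r))).sub h1
    have h3 := h2.prodMk ((sumc.comp (.fst ℝ _ ℝ)).hasFDerivAt (x := (v, r)))
    refine h3.congr_of_eventuallyEq (Filter.Eventually.of_forall fun q => ?_)
    simp [F, Lc, sumc]
  have hG2 : fderiv ℝ F u ∘L .inr ℝ ℝ ((T → ℝ) × ℝ) = G' := by
    have h1 : HasFDerivAt F (fderiv ℝ F u) (θ₀, (v, r)) :=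
      (hF.differentiable hn).differentiableAt.hasFDerivAt
    exact (h1.comp (v, r) (hasFDerivAt_prodMk_right θ₀ (v, r))).unique hG
  have hinj : Function.Injective G' := by
    refine (injective_iff_map_eq_zero G').2 ?_
    rintro ⟨w, l⟩ hw
    have hw1 : (M θ₀).mulVec w - (r • w + l • v) = 0 := congrArg Prod.fst hw
    have hw2 : ∑ x, w x = 0 := by simpa [G', sumc] using congrArg Prod.snd hw
    obtain ⟨z, hz, hzl⟩ := exists_left_eigenvector (hirr θ₀)
    have hzv : 0 < z ⬝ᵥ v := Finset.sum_pos (fun x _ => mul_pos (hz x) (hv x)) Finset.univ_nonempty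
    have hl : l = 0 := by
      have h1 := congrArg (fun t => z ⬝ᵥ t) hw1
      simp only [dotProduct_sub, dotProduct_add, dotProduct_smul, Matrix.dotProduct_mulVec, hzl,
        smul_dotProduct, dotProduct_zero, smul_eq_mul] at h1
      have h2 : l * (z ⬝ᵥ v) = 0 := by linarith
      exact (mul_eq_zero.1 h2).resolve_right hzv.ne'
    subst hl
    have hw3 : (M θ₀).mulVec w = r • w := by simpa [sub_eq_zero] using hw1
    obtain ⟨c, rfl⟩ := eigenvector_unique (hirr θ₀) hv heig hw3
    have hc : c = 0 := by
      simpa [← Finset.mul_sum, hs] using hw2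
    simp [hc]
  have hinv : (fderiv ℝ F u ∘L .inr ℝ ℝ ((T → ℝ) × ℝ)).IsInvertible := by
    rw [hG2]
    exact ⟨(LinearEquiv.ofInjectiveEndo (G' : (T → ℝ) × ℝ →ₗ[ℝ] (T → ℝ) × ℝ)
      hinj).toContinuousLinearEquiv, by ext <;> rfl⟩
  have hFat : ContDiffAt ℝ n F u := hF.contDiffAt
  set ψ := hFat.implicitFunction hn hinv with hψ
  have hψ0 : ψ θ₀ = (v, r) := hFat.implicitFunction_apply_self hn hinv
  have hψs : ContDiffAt ℝ n ψ θ₀ := hFat.contDiffAt_implicitFunction hn hinv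
  have hψe : ∀ᶠ θ in 𝓝 θ₀, F (θ, ψ θ) = F u := hFat.eventually_apply_implicitFunction hn hinv
  have hψ1 : ∀ x, ∀ᶠ θ in 𝓝 θ₀, 0 < (ψ θ).1 x := by
    intro x
    have hc : ContinuousAt (fun θ => (ψ θ).1 x) θ₀ :=
      (continuous_apply x).continuousAt.comp hψs.continuousAt.fst
    exact hc.eventually_const_lt (by simpa [hψ0] using hv x)
  have hψ2 : ∀ᶠ θ in 𝓝 θ₀, 0 < (ψ θ).2 :=
    hψs.continuousAt.snd.eventually_const_lt (by simpa [hψ0] using hr)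
  have hev : ∀ᶠ θ in 𝓝 θ₀, specRad (M θ) = (ψ θ).2 ∧ perronProb (M θ) = (ψ θ).1 := by
    filter_upwards [hψe, Filter.eventually_all.2 hψ1, hψ2] with θ h1 h2 h3
    rw [hFu] at h1
    exact perron_unique (hirr θ) h3.le h2 (congrArg Prod.snd h1)
      (sub_eq_zero.1 (congrArg Prod.fst h1))
  constructor
  · exact hψs.snd.congr_of_eventuallyEq (hev.mono fun θ h => h.1)
  · intro x
    refine ContDiffAt.congr_of_eventuallyEq (f := fun θ => (ψ θ).1 x) ?_
      (hev.mono fun θ h => congrFun h.2 x)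
    exact contDiffAt_pi.1 hψs.fst x

end Smooth

end TiltedChain

/-! ### The twisted chain and its score -/

namespace TiltedChain

open scoped Topology ContDiff

section Twist

lemma irreducible_mono {T : Type*} {A B : Matrix T T ℝ} (hA : A.IsIrreducible)
    (hB : ∀ x y, 0 ≤ B x y) (h : ∀ x y, 0 < A x y → 0 < B x y) : B.IsIrreducible := by
  refine ⟨hB, fun x y => ?_⟩
  let : Quiver T := B.toQuiver
  obtain ⟨z, hz⟩ := irreducible_exists_succ hA x
  refine irreducible_propagate hA (Q := fun y => ∃ p : Quiver.Path x y, 0 < p.length)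
    (fun a b hab ⟨p, hp⟩ => ?_) (x := z) ?_ y
  · exact ⟨p.cons (PLift.up (h a b hab)), by simp⟩
  · exact ⟨Quiver.Path.nil.cons (PLift.up (h x z hz)), by simp⟩

variable {S : Type*} [Fintype S] [DecidableEq S] {P : Matrix S S ℝ}

omit [Fintype S] [DecidableEq S] in
lemma tilt_irreducible (hirr : P.IsIrreducible) (f : S → ℝ) (θ : ℝ) :
    (tilt P f θ).IsIrreducible :=
  irreducible_mono hirr (fun x y => mul_nonneg (hirr.nonneg x y) (Real.exp_pos _).le)
    fun _ _ h => mul_pos h (Real.exp_pos _)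

/-- The logarithm of the `x`-entry of the right Perron-Frobenius eigenvector of total mass one of
the tilted matrix. -/
noncomputable def logEigen (P : Matrix S S ℝ) (f : S → ℝ) (x : S) (θ : ℝ) : ℝ :=
  Real.log (perronProb (tilt P f θ) x)

/-- The Doob transform of the tilted matrix: the stochastic matrix
`P(x, y) exp(θ f(y)) v_θ(y) / (ρ(θ) v_θ(x))`. -/
noncomputable def twist (P : Matrix S S ℝ) (f : S → ℝ) (θ : ℝ) : Matrix S S ℝ :=
  Matrix.of fun x y =>
    P x y * Real.exp (θ * f y - Lam P f θ + logEigen P f y θ - logEigen P f x θ)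

/-- The score `d/dθ log P_θ(x, y)` of the twisted chain. -/
noncomputable def score (P : Matrix S S ℝ) (f : S → ℝ) (θ : ℝ) (x y : S) : ℝ :=
  f y - deriv (Lam P f) θ + deriv (logEigen P f y) θ - deriv (logEigen P f x) θ

variable [Nonempty S] (hirr : P.IsIrreducible) (f : S → ℝ)

include hirr

lemma specRad_tilt_pos (θ : ℝ) : 0 < specRad (tilt P f θ) :=
  (exists_isPerronPair (tilt_irreducible hirr f θ)).1

lemma contDiff_tilt_perron :
    ContDiff ℝ 2 (Lam P f) ∧ ∀ x, ContDiff ℝ 2 (logEigen P f x) := by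
  have h := fun θ => contDiffAt_perron (n := 2) two_ne_zero (M := fun θ => tilt P f θ)
    (fun x y => by simp only [tilt, Matrix.of_apply]; fun_prop) (tilt_irreducible hirr f) θ
  refine ⟨contDiff_iff_contDiffAt.2 fun θ => (h θ).1.log (specRad_tilt_pos hirr f θ).ne',
    fun x => contDiff_iff_contDiffAt.2 fun θ => ((h θ).2 x).log ?_⟩
  exact (perronProb_pos (tilt_irreducible hirr f θ) x).ne'

lemma hasDerivAt_Lam (θ : ℝ) : HasDerivAt (Lam P f) (deriv (Lam P f) θ) θ :=
  ((contDiff_tilt_perron hirr f).1.differentiable two_ne_zero θ).hasDerivAt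

lemma hasDerivAt_deriv_Lam (θ : ℝ) :
    HasDerivAt (deriv (Lam P f)) (deriv (deriv (Lam P f)) θ) θ :=
  ((contDiff_tilt_perron hirr f).1.differentiable_deriv_two θ).hasDerivAt

lemma hasDerivAt_logEigen (x : S) (θ : ℝ) :
    HasDerivAt (logEigen P f x) (deriv (logEigen P f x) θ) θ :=
  (((contDiff_tilt_perron hirr f).2 x).differentiable two_ne_zero θ).hasDerivAt

lemma hasDerivAt_deriv_logEigen (x : S) (θ : ℝ) :
    HasDerivAt (deriv (logEigen P f x)) (deriv (deriv (logEigen P f x)) θ) θ :=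
  (((contDiff_tilt_perron hirr f).2 x).differentiable_deriv_two θ).hasDerivAt

lemma exp_logEigen (x : S) (θ : ℝ) :
    Real.exp (logEigen P f x θ) = perronProb (tilt P f θ) x :=
  Real.exp_log (perronProb_pos (tilt_irreducible hirr f θ) x)

lemma vRatio_eq (x y : S) (θ : ℝ) :
    vRatio P f x y θ = Real.exp (logEigen P f x θ - logEigen P f y θ) := by
  rw [vRatio, perronRight_div (tilt_irreducible hirr f θ), Real.exp_sub, exp_logEigen hirr,
    exp_logEigen hirr]

lemma vRatio_pos (x y : S) (θ : ℝ) : 0 < vRatio P f x y θ := by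
  rw [vRatio_eq hirr]; exact Real.exp_pos _

lemma vRatio_self (x : S) (θ : ℝ) : vRatio P f x x θ = 1 := by
  rw [vRatio_eq hirr, sub_self, Real.exp_zero]

lemma vRatio_mul_swap (x y : S) (θ : ℝ) : vRatio P f x y θ * vRatio P f y x θ = 1 := by
  rw [vRatio_eq hirr, vRatio_eq hirr, ← Real.exp_add]; simp

lemma hasDerivAt_vRatio (x y : S) (θ : ℝ) :
    HasDerivAt (vRatio P f x y)
      (vRatio P f x y θ * (deriv (logEigen P f x) θ - deriv (logEigen P f y) θ)) θ := by
  have h := ((hasDerivAt_logEigen hirr f x θ).sub (hasDerivAt_logEigen hirr f y θ)).exp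
  rw [funext (vRatio_eq hirr f x y)]
  exact h

/-- The eigenvector equation written with ratios of entries. -/
lemma sum_tilt_mul_vRatio (θ : ℝ) (x : S) :
    ∑ y, tilt P f θ x y * vRatio P f y x θ = specRad (tilt P f θ) := by
  have hθ := tilt_irreducible hirr f θ
  have h := congrFun (perronRight_spec hθ).2 x
  rw [mulVec_apply_eq] at h
  simp only [vRatio, mul_div_assoc']
  rw [← Finset.sum_div, h]
  exact mul_div_cancel_right₀ _ ((perronRight_spec hθ).1 x).ne'

lemma twist_eq (θ : ℝ) (x y : S) :
    twist P f θ x y = tilt P f θ x y * vRatio P f y x θ / specRad (tilt P f θ) := by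
  rw [twist, Matrix.of_apply, tilt, Matrix.of_apply, ← tilt, vRatio_eq hirr, mul_assoc,
    ← Real.exp_add]
  rw [eq_div_iff (specRad_tilt_pos hirr f θ).ne',
    ← Real.exp_log (specRad_tilt_pos hirr f θ), ← Lam, mul_assoc, ← Real.exp_add]
  congr 2
  ring

lemma sum_twist (θ : ℝ) (x : S) : ∑ y, twist P f θ x y = 1 := by
  simp_rw [twist_eq hirr f, ← Finset.sum_div, sum_tilt_mul_vRatio hirr f]
  exact div_self (specRad_tilt_pos hirr f θ).ne'

omit [Nonempty S] in
lemma twist_irreducible (θ : ℝ) : (twist P f θ).IsIrreducible :=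
  irreducible_mono hirr (fun x y => mul_nonneg (hirr.nonneg x y) (Real.exp_pos _).le)
    fun _ _ h => mul_pos h (Real.exp_pos _)

lemma exists_stationary (θ : ℝ) :
    ∃ w : S → ℝ, (∀ x, 0 < w x) ∧ ∑ x, w x = 1 ∧ ∀ y, ∑ x, w x * twist P f θ x y = w y := by
  have hθ := twist_irreducible hirr f θ
  have h1 : specRad (twist P f θ) = 1 :=
    specRad_eq_of_pos_eigenvector hθ.nonneg zero_le_one (v := fun _ => 1) (fun _ => one_pos)
      (by funext x; simp [mulVec_apply_eq, sum_twist hirr f])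
  obtain ⟨-, u, v, huv⟩ := exists_isPerronPair hθ
  refine ⟨u, huv.left_pos, huv.sum_left, fun y => ?_⟩
  have := congrFun huv.left_eigen y
  rw [h1, one_smul] at this
  exact this

lemma hasDerivAt_twist (θ : ℝ) (x y : S) :
    HasDerivAt (fun θ => twist P f θ x y) (twist P f θ x y * score P f θ x y) θ := by
  have h := ((((((hasDerivAt_id θ).mul_const (f y)).sub (hasDerivAt_Lam hirr f θ)).add
    (hasDerivAt_logEigen hirr f y θ)).sub (hasDerivAt_logEigen hirr f x θ)).exp).const_mul (P x y)
  refine h.congr_deriv ?_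
  simp only [twist, Matrix.of_apply, score]
  simp
  ring

lemma sum_twist_mul_score (θ : ℝ) (x : S) : ∑ y, twist P f θ x y * score P f θ x y = 0 := by
  have h := HasDerivAt.fun_sum (u := Finset.univ) fun y _ => hasDerivAt_twist hirr f θ x y
  simp only [sum_twist hirr f] at h
  exact h.unique (hasDerivAt_const θ 1)

lemma hasDerivAt_score (θ : ℝ) (x y : S) :
    HasDerivAt (fun θ => score P f θ x y) (-deriv (deriv (Lam P f)) θ +
      deriv (deriv (logEigen P f y)) θ - deriv (deriv (logEigen P f x)) θ) θ := by
  have h := (((hasDerivAt_const θ (f y)).sub (hasDerivAt_deriv_Lam hirr f θ)).add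
    (hasDerivAt_deriv_logEigen hirr f y θ)).sub (hasDerivAt_deriv_logEigen hirr f x θ)
  refine h.congr_deriv ?_
  ring

lemma sum_twist_mul_score_sq (θ : ℝ) (x : S) :
    ∑ y, twist P f θ x y * score P f θ x y ^ 2 = deriv (deriv (Lam P f)) θ -
      ∑ y, twist P f θ x y * deriv (deriv (logEigen P f y)) θ +
      deriv (deriv (logEigen P f x)) θ := by
  have h := HasDerivAt.fun_sum (u := Finset.univ)
    fun y _ => (hasDerivAt_twist hirr f θ x y).mul (hasDerivAt_score hirr f θ x y)
  have h0 := h.unique ((hasDerivAt_const θ (0 : ℝ)).congr_of_eventuallyEq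
    (Filter.Eventually.of_forall fun θ => sum_twist_mul_score hirr f θ x))
  have h1 := sum_twist hirr f θ x
  have h2 : ∑ y, twist P f θ x y * (-deriv (deriv (Lam P f)) θ +
      deriv (deriv (logEigen P f y)) θ - deriv (deriv (logEigen P f x)) θ) =
      -deriv (deriv (Lam P f)) θ + ∑ y, twist P f θ x y * deriv (deriv (logEigen P f y)) θ -
        deriv (deriv (logEigen P f x)) θ := by
    simp only [mul_sub, mul_add, Finset.sum_sub_distrib, Finset.sum_add_distrib,
      ← Finset.sum_mul, h1, one_mul]
  rw [Finset.sum_add_distrib, h2] at h0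
  have h3 : ∑ y, twist P f θ x y * score P f θ x y ^ 2 =
      ∑ y, twist P f θ x y * score P f θ x y * score P f θ x y :=
    Finset.sum_congr rfl fun y _ => by ring
  linarith

omit hirr [Nonempty S] [DecidableEq S] in
lemma stationary_sum {A : Matrix S S ℝ} {w : S → ℝ} (hst : ∀ y, ∑ x, w x * A x y = w y)
    (φ : S → ℝ) : ∑ x, w x * ∑ y, A x y * φ y = ∑ y, w y * φ y := by
  simp_rw [Finset.mul_sum]
  rw [Finset.sum_comm]
  refine Finset.sum_congr rfl fun y _ => ?_
  rw [← hst y, Finset.sum_mul]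
  exact Finset.sum_congr rfl fun x _ => by ring

/-- `Λ'(θ)` is the mean of `f` under the stationary distribution of the twisted chain. -/
lemma deriv_Lam_eq {θ : ℝ} {w : S → ℝ} (hw : ∑ x, w x = 1)
    (hst : ∀ y, ∑ x, w x * twist P f θ x y = w y) :
    deriv (Lam P f) θ = ∑ x, w x * f x := by
  have h : ∀ x, ∑ y, twist P f θ x y * (f y + deriv (logEigen P f y) θ) =
      deriv (Lam P f) θ + deriv (logEigen P f x) θ := by
    intro x
    have h1 := sum_twist_mul_score hirr f θ x
    have h2 := sum_twist hirr f θ x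
    have h3 : ∀ y, twist P f θ x y * score P f θ x y =
        twist P f θ x y * (f y + deriv (logEigen P f y) θ) -
          twist P f θ x y * (deriv (Lam P f) θ + deriv (logEigen P f x) θ) := fun y => by
      rw [score]; ring
    simp_rw [h3, Finset.sum_sub_distrib, ← Finset.sum_mul, h2] at h1
    linarith
  have h4 := stationary_sum hst fun y => f y + deriv (logEigen P f y) θ
  simp_rw [h, mul_add, Finset.sum_add_distrib, ← Finset.sum_mul, hw] at h4
  linarith

/-- `Λ''(θ)` is the variance of the score of the stationary twisted chain. -/
lemma deriv2_Lam_eq {θ : ℝ} {w : S → ℝ} (hw : ∑ x, w x = 1)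
    (hst : ∀ y, ∑ x, w x * twist P f θ x y = w y) :
    deriv (deriv (Lam P f)) θ = ∑ x, w x * ∑ y, twist P f θ x y * score P f θ x y ^ 2 := by
  have h4 := stationary_sum hst fun y => deriv (deriv (logEigen P f y)) θ
  simp_rw [sum_twist_mul_score_sq hirr f, mul_add, mul_sub, Finset.sum_add_distrib,
    Finset.sum_sub_distrib, ← Finset.sum_mul, hw, h4]
  ring

end Twist

end TiltedChain

/-! ### Bounds that are uniform in the tilting parameter -/

namespace TiltedChain

section Uniform

lemma exists_pos_lower_bound {ι : Type*} [Finite ι] (g : ι → ℝ) :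
    ∃ p : ℝ, 0 < p ∧ ∀ i, 0 < g i → p ≤ g i := by
  rcases isEmpty_or_nonempty {i // 0 < g i} with h | h
  · exact ⟨1, one_pos, fun i hi => (h.false ⟨i, hi⟩).elim⟩
  · obtain ⟨i, hi⟩ := Finite.exists_min fun i : {i // 0 < g i} => g i
    exact ⟨g i, i.2, fun j hj => hi ⟨j, hj⟩⟩

variable {S : Type*} [Fintype S] [DecidableEq S] {P : Matrix S S ℝ}

lemma tilt_le_specRad_mul [Nonempty S] (hirr : P.IsIrreducible) (f : S → ℝ) (θ : ℝ) (x y : S) :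
    tilt P f θ x y * perronProb (tilt P f θ) y ≤
      specRad (tilt P f θ) * perronProb (tilt P f θ) x := by
  have hθ := tilt_irreducible hirr f θ
  have h := congrFun (mulVec_perronProb hθ) x
  rw [mulVec_apply_eq] at h
  simp only [Pi.smul_apply, smul_eq_mul] at h
  rw [← h]
  exact Finset.single_le_sum
    (f := fun y => tilt P f θ x y * perronProb (tilt P f θ) y)
    (fun z _ => mul_nonneg (hθ.nonneg x z) (perronProb_pos hθ z).le) (Finset.mem_univ y)

lemma specRad_tilt_le [Nonempty S] (hP : P ∈ Matrix.rowStochastic ℝ S) (hirr : P.IsIrreducible)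
    {f : S → ℝ} {b : ℝ} (hb : ∀ x, f x ≤ b) {θ : ℝ} (hθ : 0 ≤ θ) :
    specRad (tilt P f θ) ≤ Real.exp (θ * b) := by
  have hi := tilt_irreducible hirr f θ
  obtain ⟨x, hx⟩ := Finite.exists_max fun x => perronProb (tilt P f θ) x
  have h := congrFun (mulVec_perronProb hi) x
  rw [mulVec_apply_eq] at h
  simp only [Pi.smul_apply, smul_eq_mul] at h
  refine le_of_mul_le_mul_right (a := perronProb (tilt P f θ) x) ?_ (perronProb_pos hi x)
  calc _ = ∑ y, tilt P f θ x y * perronProb (tilt P f θ) y := h.symm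
    _ ≤ ∑ y, P x y * (Real.exp (θ * b) * perronProb (tilt P f θ) x) := by
        refine Finset.sum_le_sum fun y _ => ?_
        rw [tilt, Matrix.of_apply, mul_assoc, ← tilt]
        refine mul_le_mul_of_nonneg_left ?_ (hirr.nonneg x y)
        exact mul_le_mul (Real.exp_le_exp.2 (mul_le_mul_of_nonneg_left (hb y) hθ)) (hx y)
          (perronProb_pos hi y).le (Real.exp_pos _).le
    _ = _ := by rw [← Finset.sum_mul, Matrix.sum_row_of_mem_rowStochastic hP, one_mul]

/-- The part of the hypotheses of the tail bound that makes the Perron-Frobenius data converge as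
`θ → ∞`: the matrix restricted to the maximizers of `f` is irreducible, and the maximizers are
reached in one step from everywhere else. -/
structure MaxSetReachable (P : Matrix S S ℝ) (f : S → ℝ) (b : ℝ) : Prop where
  irreducible : (P.submatrix (fun x : {x : S // f x = b} => (x : S))
    (fun x : {x : S // f x = b} => (x : S))).IsIrreducible
  reach : ∀ x : S, f x ≠ b → ∃ y : S, f y = b ∧ 0 < P x y

omit [Fintype S] [DecidableEq S] in
lemma MaxSetReachable.exists_succ {f : S → ℝ} {b : ℝ} (h : MaxSetReachable P f b) (x : S) :
    ∃ y : S, f y = b ∧ 0 < P x y := by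
  by_cases hx : f x = b
  · obtain ⟨y, hy⟩ := irreducible_exists_succ h.irreducible ⟨x, hx⟩
    exact ⟨y, y.2, hy⟩
  · exact h.reach x hx

variable [Nonempty S]

lemma le_specRad_tilt (hirr : P.IsIrreducible) {f : S → ℝ} {b p : ℝ}
    (hmax : MaxSetReachable P f b) (hp : ∀ x y, 0 < P x y → p ≤ P x y) (θ : ℝ) :
    p * Real.exp (θ * b) ≤ specRad (tilt P f θ) := by
  have hi := tilt_irreducible hirr f θ
  obtain ⟨x, hx⟩ := Finite.exists_min fun x => perronProb (tilt P f θ) x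
  obtain ⟨y, hy, hxy⟩ := hmax.exists_succ x
  have h := tilt_le_specRad_mul hirr f θ x y
  rw [tilt, Matrix.of_apply, ← tilt, hy] at h
  refine le_of_mul_le_mul_right (le_trans ?_ h) (perronProb_pos hi x)
  exact mul_le_mul (mul_le_mul_of_nonneg_right (hp x y hxy) (Real.exp_pos _).le) (hx y)
    (perronProb_pos hi x).le (mul_nonneg hxy.le (Real.exp_pos _).le)

/-- Uniform comparability of the entries of the right eigenvector. On the set of maximizers this is
the Harnack inequality, whose edge constant does not depend on `θ`. Off that set the entries are
controlled by those on it once `θ` is so large that the tilted weights there are negligible; for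
the remaining bounded range of `θ` the Harnack inequality on all of `S` applies. -/
theorem exists_vRatio_le (hP : P ∈ Matrix.rowStochastic ℝ S) (hirr : P.IsIrreducible)
    {f : S → ℝ} {a b : ℝ} (ha : ∀ x, a ≤ f x) (hb : ∀ x, f x ≤ b)
    (hmax : MaxSetReachable P f b) :
    ∃ K : ℝ, ∀ θ : ℝ, 0 ≤ θ → ∀ x y, vRatio P f x y θ ≤ K := by
  obtain ⟨p, hp0, hp'⟩ := exists_pos_lower_bound fun q : S × S => P q.1 q.2
  have hp : ∀ x y, 0 < P x y → p ≤ P x y := fun x y => hp' (x, y)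
  obtain ⟨δ, hδ0, hδ'⟩ := exists_pos_lower_bound fun x => b - f x
  have hδ : ∀ x, f x ≠ b → f x ≤ b - δ := fun x hx => by
    have := hδ' x (sub_pos.2 (lt_of_le_of_ne (hb x) hx))
    linarith
  set Θ := -Real.log (p / 2) / δ with hΘ
  obtain ⟨K₁, hK₁0, hK₁⟩ := irreducible_harnack hmax.irreducible (inv_pos.2 hp0).le
  obtain ⟨K₃, hK₃0, hK₃⟩ := irreducible_harnack hirr
    (C := Real.exp (Θ * (b - a)) / p) (by positivity)
  have hab : a ≤ b := (ha (Classical.arbitrary S)).trans (hb _)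
  set K₂ := K₁ * p⁻¹ with hK₂
  have hK₂0 : 0 ≤ K₂ := by positivity
  refine ⟨max (2 * K₂ / p * K₂) K₃, fun θ hθ x y => ?_⟩
  have hi := tilt_irreducible hirr f θ
  set v := perronProb (tilt P f θ) with hv
  set ρ := specRad (tilt P f θ) with hρ
  have hv0 : ∀ x, 0 < v x := perronProb_pos hi
  have hρle : ρ ≤ Real.exp (θ * b) := specRad_tilt_le hP hirr hb hθ
  have hρge : p * Real.exp (θ * b) ≤ ρ := le_specRad_tilt hirr hmax hp θ
  have hedge : ∀ x y, f y = b → 0 < P x y → v y ≤ p⁻¹ * v x := by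
    intro x y hy hxy
    have h1 := tilt_le_specRad_mul hirr f θ x y
    rw [tilt, Matrix.of_apply, ← tilt, hy] at h1
    have h2 : p * Real.exp (θ * b) * v y ≤ Real.exp (θ * b) * v x :=
      (mul_le_mul_of_nonneg_right (mul_le_mul_of_nonneg_right (hp x y hxy) (Real.exp_pos _).le)
        (hv0 y).le).trans (h1.trans (mul_le_mul_of_nonneg_right hρle (hv0 x).le))
    have h3 : p * v y ≤ v x := by
      refine le_of_mul_le_mul_left (a := Real.exp (θ * b)) ?_ (Real.exp_pos _)
      linarith
    rw [inv_mul_eq_div, le_div_iff₀ hp0]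
    linarith
  have hmaxset : ∀ x y, f y = b → v y ≤ K₂ * v x := by
    intro x y hy
    obtain ⟨z, hz, hxz⟩ := hmax.exists_succ x
    have h1 := hK₁ (fun x => v x) (fun x => (hv0 x).le)
      (fun x y hxy => hedge x y y.2 hxy) ⟨z, hz⟩ ⟨y, hy⟩
    calc v y ≤ K₁ * v z := h1
      _ ≤ K₁ * (p⁻¹ * v x) := mul_le_mul_of_nonneg_left (hedge x z hz hxz) hK₁0
      _ = K₂ * v x := by rw [hK₂]; ring
  rw [vRatio, perronRight_div hi, div_le_iff₀ (hv0 y)]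
  change v x ≤ _ * v y
  rcases le_total (Real.exp (-(θ * δ))) (p / 2) with hlarge | hsmall
  · refine le_trans ?_ (mul_le_mul_of_nonneg_right (le_max_left _ _) (hv0 y).le)
    obtain ⟨z, hz, -⟩ := hmax.exists_succ x
    obtain ⟨m, hm⟩ := Finite.exists_max v
    have hm' : p * v m ≤ K₂ * v z + Real.exp (-(θ * δ)) * v m := by
      have h := congrFun (mulVec_perronProb hi) m
      rw [mulVec_apply_eq] at h
      simp only [Pi.smul_apply, smul_eq_mul] at h
      have h1 : ∑ y, tilt P f θ m y * v y ≤
          ∑ y, P m y * (Real.exp (θ * b) * (K₂ * v z + Real.exp (-(θ * δ)) * v m)) := by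
        refine Finset.sum_le_sum fun y _ => ?_
        rw [tilt, Matrix.of_apply, mul_assoc]
        refine mul_le_mul_of_nonneg_left ?_ (hirr.nonneg m y)
        by_cases hy : f y = b
        · rw [hy]
          refine mul_le_mul_of_nonneg_left ?_ (Real.exp_pos _).le
          have := mul_pos (Real.exp_pos (-(θ * δ))) (hv0 m)
          linarith [hmaxset z y hy]
        · calc Real.exp (θ * f y) * v y
              ≤ Real.exp (θ * (b - δ)) * v m :=
                mul_le_mul (Real.exp_le_exp.2 (mul_le_mul_of_nonneg_left (hδ y hy) hθ)) (hm y)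
                  (hv0 y).le (Real.exp_pos _).le
            _ = Real.exp (θ * b) * (Real.exp (-(θ * δ)) * v m) := by
                rw [← mul_assoc, ← Real.exp_add]
                congr 2
                ring
            _ ≤ _ := by
                refine mul_le_mul_of_nonneg_left ?_ (Real.exp_pos _).le
                have := mul_nonneg hK₂0 (hv0 z).le
                linarith
      rw [← Finset.sum_mul, Matrix.sum_row_of_mem_rowStochastic hP, one_mul, h] at h1
      have h2 := (mul_le_mul_of_nonneg_right hρge (hv0 m).le).trans h1
      refine le_of_mul_le_mul_left (a := Real.exp (θ * b)) ?_ (Real.exp_pos _)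
      linarith
    have h1 : v m ≤ 2 * K₂ / p * v z := by
      have := mul_le_mul_of_nonneg_right hlarge (hv0 m).le
      rw [div_mul_eq_mul_div, le_div_iff₀ hp0]
      linarith
    calc v x ≤ v m := hm x
      _ ≤ 2 * K₂ / p * v z := h1
      _ ≤ 2 * K₂ / p * (K₂ * v y) :=
          mul_le_mul_of_nonneg_left (hmaxset y z hz) (by positivity)
      _ = _ := by ring
  · refine le_trans ?_ (mul_le_mul_of_nonneg_right (le_max_right _ _) (hv0 y).le)
    have hθΘ : θ ≤ Θ := by
      rw [hΘ, le_div_iff₀ hδ0]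
      have := (Real.log_le_iff_le_exp (by positivity)).2 hsmall
      linarith
    refine hK₃ v (fun x => (hv0 x).le) (fun x y hxy => ?_) y x
    have h1 := (tilt_le_specRad_mul hirr f θ x y).trans
      (mul_le_mul_of_nonneg_right hρle (hv0 x).le)
    rw [tilt, Matrix.of_apply, ← tilt] at h1
    have h2 : p * Real.exp (θ * f y) * v y ≤ Real.exp (θ * b) * v x :=
      (mul_le_mul_of_nonneg_right (mul_le_mul_of_nonneg_right (hp x y hxy) (Real.exp_pos _).le)
        (hv0 y).le).trans h1
    have h3 : Real.exp (θ * b) ≤ Real.exp (θ * f y) * Real.exp (Θ * (b - a)) := by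
      rw [← Real.exp_add, Real.exp_le_exp]
      have h4 : θ * (b - f y) ≤ Θ * (b - a) :=
        mul_le_mul hθΘ (by linarith [ha y]) (by linarith [hb y]) (hθ.trans hθΘ)
      linarith
    have h4 : p * v y ≤ Real.exp (Θ * (b - a)) * v x := by
      refine le_of_mul_le_mul_left (a := Real.exp (θ * f y)) ?_ (Real.exp_pos _)
      linarith [mul_le_mul_of_nonneg_right h3 (hv0 x).le]
    rw [div_mul_eq_mul_div, le_div_iff₀ hp0]
    linarith

lemma deriv_Lam_mem_Icc (hirr : P.IsIrreducible)
    {f : S → ℝ} {a b : ℝ} (ha : ∀ x, a ≤ f x) (hb : ∀ x, f x ≤ b) (θ : ℝ) :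
    deriv (Lam P f) θ ∈ Set.Icc a b := by
  obtain ⟨w, hw0, hw1, hst⟩ := exists_stationary hirr f θ
  rw [deriv_Lam_eq hirr f hw1 hst]
  constructor
  · calc a = ∑ x, w x * a := by rw [← Finset.sum_mul, hw1, one_mul]
      _ ≤ _ := Finset.sum_le_sum fun x _ => mul_le_mul_of_nonneg_left (ha x) (hw0 x).le
  · calc _ ≤ ∑ x, w x * b :=
          Finset.sum_le_sum fun x _ => mul_le_mul_of_nonneg_left (hb x) (hw0 x).le
      _ = b := by rw [← Finset.sum_mul, hw1, one_mul]

/-- The logarithmic derivative `h` of the eigenvector solves the Poisson equation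
`h - P_θ h = P_θ f - Λ'(θ)` of the twisted chain, whose transition probabilities into the set of
maximizers are bounded below. The oscillation of `h` is therefore bounded uniformly in `θ`. -/
theorem exists_logEigen_deriv_sub_le (hP : P ∈ Matrix.rowStochastic ℝ S) (hirr : P.IsIrreducible)
    {f : S → ℝ} {a b : ℝ} (ha : ∀ x, a ≤ f x) (hb : ∀ x, f x ≤ b)
    (hmax : MaxSetReachable P f b) :
    ∃ C : ℝ, ∀ θ : ℝ, 0 ≤ θ → ∀ x y,
      deriv (logEigen P f x) θ - deriv (logEigen P f y) θ ≤ C := by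
  obtain ⟨K, hK⟩ := exists_vRatio_le hP hirr ha hb hmax
  obtain ⟨p, hp0, hp'⟩ := exists_pos_lower_bound fun q : S × S => P q.1 q.2
  have hp : ∀ x y, 0 < P x y → p ≤ P x y := fun x y => hp' (x, y)
  have hK0 : 0 < K := by
    have := hK 0 le_rfl (Classical.arbitrary S) (Classical.arbitrary S)
    rw [vRatio_self hirr] at this
    linarith
  set ε := p / K with hε
  have hε0 : 0 < ε := div_pos hp0 hK0
  set E := ε⁻¹ + 1 with hE
  have hE0 : 0 < E := by positivity
  obtain ⟨K₄, hK₄0, hK₄⟩ := irreducible_harnack hmax.irreducible hE0.le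
  set D := b - a with hD
  have hD0 : 0 ≤ D := sub_nonneg.2 ((ha (Classical.arbitrary S)).trans (hb _))
  set C := K₄ * (E * D) with hC
  refine ⟨(D + C) / ε, fun θ hθ x y => ?_⟩
  have htw : ∀ x y, f y = b → 0 < P x y → ε ≤ twist P f θ x y := by
    intro x y hy hxy
    have h1 : 1 ≤ K * vRatio P f y x θ := by
      rw [← vRatio_mul_swap hirr f x y θ]
      exact mul_le_mul_of_nonneg_right (hK θ hθ x y) (vRatio_pos hirr f y x θ).le
    rw [twist_eq hirr f, hε, div_le_div_iff₀ hK0 (specRad_tilt_pos hirr f θ), tilt,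
      Matrix.of_apply, hy, ← tilt]
    calc p * specRad (tilt P f θ) ≤ p * Real.exp (θ * b) * 1 := by
          rw [mul_one]
          exact mul_le_mul_of_nonneg_left (specRad_tilt_le hP hirr hb hθ) hp0.le
      _ ≤ P x y * Real.exp (θ * b) * (K * vRatio P f y x θ) :=
          mul_le_mul (mul_le_mul_of_nonneg_right (hp x y hxy) (Real.exp_pos _).le) h1
            zero_le_one (mul_nonneg hxy.le (Real.exp_pos _).le)
      _ = _ := by ring
  have htw0 : ∀ x y, 0 ≤ twist P f θ x y := (twist_irreducible hirr f θ).nonneg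
  set h := fun x => deriv (logEigen P f x) θ with hh
  obtain ⟨t, ht⟩ := Finite.exists_max h
  set k := fun x => h t - h x with hk
  have hk0 : ∀ x, 0 ≤ k x := fun x => sub_nonneg.2 (ht x)
  have hΛ := deriv_Lam_mem_Icc hirr ha hb θ
  have hpois : ∀ x, |∑ y, twist P f θ x y * k y - k x| ≤ D := by
    intro x
    have h1 := sum_twist_mul_score hirr f θ x
    have h2 := sum_twist hirr f θ x
    have h3 : ∑ y, twist P f θ x y * k y - k x =
        ∑ y, twist P f θ x y * (f y - deriv (Lam P f) θ) := by
      have h4 : ∀ y, twist P f θ x y * score P f θ x y =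
          twist P f θ x y * (f y - deriv (Lam P f) θ) - twist P f θ x y * k y +
            twist P f θ x y * k x := fun y => by
        simp only [score, hk, hh]; ring
      simp_rw [h4, Finset.sum_add_distrib, Finset.sum_sub_distrib, ← Finset.sum_mul, h2] at h1
      linarith
    rw [h3]
    calc _ ≤ ∑ y, |twist P f θ x y * (f y - deriv (Lam P f) θ)| := Finset.abs_sum_le_sum_abs _ _
      _ ≤ ∑ y, twist P f θ x y * D := by
          refine Finset.sum_le_sum fun y _ => ?_
          rw [abs_mul, abs_of_nonneg (htw0 x y)]
          refine mul_le_mul_of_nonneg_left (abs_le.2 ⟨?_, ?_⟩) (htw0 x y)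
          · linarith [ha y, hΛ.2]
          · linarith [hb y, hΛ.1]
      _ = D := by rw [← Finset.sum_mul, h2, one_mul]
  have hedge : ∀ x y, f y = b → 0 < P x y → k y + D ≤ E * (k x + D) := by
    intro x y hy hxy
    have h1 : ε * k y ≤ k x + D :=
      calc ε * k y ≤ twist P f θ x y * k y :=
            mul_le_mul_of_nonneg_right (htw x y hy hxy) (hk0 y)
        _ ≤ ∑ y, twist P f θ x y * k y :=
            Finset.single_le_sum (f := fun y => twist P f θ x y * k y)
              (fun z _ => mul_nonneg (htw0 x z) (hk0 z)) (Finset.mem_univ y)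
        _ ≤ k x + D := by linarith [(abs_le.1 (hpois x)).2]
    have h2 : k y ≤ ε⁻¹ * (k x + D) := by
      rw [inv_mul_eq_div, le_div_iff₀ hε0]
      linarith
    rw [hE, add_mul, one_mul]
    linarith [hk0 x]
  have hmaxset : ∀ y, f y = b → k y ≤ C := by
    intro y hy
    obtain ⟨z, hz, htz⟩ := hmax.exists_succ t
    have h1 := hK₄ (fun x => k x + D) (fun x => add_nonneg (hk0 x) hD0)
      (fun x y hxy => hedge x y y.2 hxy) ⟨z, hz⟩ ⟨y, hy⟩
    have h2 := hedge t z hz htz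
    have h3 : k t = 0 := sub_self _
    rw [h3, zero_add] at h2
    have h4 := mul_le_mul_of_nonneg_left h2 hK₄0
    simp only at h1
    linarith
  obtain ⟨m, hm⟩ := Finite.exists_max k
  obtain ⟨z, hz, hmz⟩ := hmax.exists_succ m
  have hkm : k m ≤ (D + C) / ε := by
    have h1 : ∑ y, twist P f θ m y * (k m - k y) ≤ D := by
      have h2 := (abs_le.1 (hpois m)).1
      simp_rw [mul_sub, Finset.sum_sub_distrib, ← Finset.sum_mul, sum_twist hirr f, one_mul]
      linarith
    have h2 : twist P f θ m z * (k m - k z) ≤ D :=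
      (Finset.single_le_sum (f := fun y => twist P f θ m y * (k m - k y))
        (fun y _ => mul_nonneg (htw0 m y) (sub_nonneg.2 (hm y))) (Finset.mem_univ z)).trans h1
    have h3 : ε * (k m - k z) ≤ D :=
      (mul_le_mul_of_nonneg_right (htw m z hz hmz) (sub_nonneg.2 (hm z))).trans h2
    have h4 : k m - k z ≤ D / ε := by
      rw [le_div_iff₀ hε0]; linarith
    have h5 : C ≤ C / ε := by
      rw [le_div_iff₀ hε0]
      refine mul_le_of_le_one_right (by positivity) ?_
      refine (htw m z hz hmz).trans ?_
      rw [← sum_twist hirr f θ m]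
      exact Finset.single_le_sum (fun y _ => htw0 m y) (Finset.mem_univ z)
    rw [add_div]
    linarith [hmaxset z hz]
  have h1 : h x - h y ≤ k y := by
    simp only [hk]; linarith [ht x]
  exact h1.trans ((hm y).trans hkm)

end Uniform

end TiltedChain

/-! ### The constants of the tail bound -/

namespace TiltedChain

section Constants

variable {S : Type*} [Fintype S] [DecidableEq S] [Nonempty S] {P : Matrix S S ℝ}

lemma deriv2_Lam_nonneg (hirr : P.IsIrreducible) (f : S → ℝ) (θ : ℝ) :
    0 ≤ deriv (deriv (Lam P f)) θ := by
  obtain ⟨w, hw0, hw1, hst⟩ := exists_stationary hirr f θ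
  rw [deriv2_Lam_eq hirr f hw1 hst]
  exact Finset.sum_nonneg fun x _ => mul_nonneg (hw0 x).le (Finset.sum_nonneg fun y _ =>
    mul_nonneg ((twist_irreducible hirr f θ).nonneg x y) (sq_nonneg _))

/-- Popoviciu's inequality for the score of the stationary twisted chain. -/
lemma deriv2_Lam_le_of_score_mem (hirr : P.IsIrreducible) (f : S → ℝ) {θ α β : ℝ}
    (h : ∀ x y, score P f θ x y ∈ Set.Icc α β) :
    deriv (deriv (Lam P f)) θ ≤ (β - α) ^ 2 / 4 := by
  obtain ⟨w, hw0, hw1, hst⟩ := exists_stationary hirr f θ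
  rw [deriv2_Lam_eq hirr f hw1 hst]
  have hx : ∀ x, ∑ y, twist P f θ x y * score P f θ x y ^ 2 ≤ -(α * β) := by
    intro x
    calc _ ≤ ∑ y, ((α + β) * (twist P f θ x y * score P f θ x y) -
          twist P f θ x y * (α * β)) := by
          refine Finset.sum_le_sum fun y _ => ?_
          have h1 : score P f θ x y ^ 2 ≤ (α + β) * score P f θ x y - α * β := by
            have := mul_nonneg (sub_nonneg.2 (h x y).1) (sub_nonneg.2 (h x y).2)
            linarith
          have := mul_le_mul_of_nonneg_left h1 ((twist_irreducible hirr f θ).nonneg x y)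
          linarith
      _ = -(α * β) := by
          rw [Finset.sum_sub_distrib, ← Finset.mul_sum, sum_twist_mul_score hirr f,
            ← Finset.sum_mul, sum_twist hirr f]
          ring
  calc _ ≤ ∑ x, w x * (-(α * β)) :=
        Finset.sum_le_sum fun x _ => mul_le_mul_of_nonneg_left (hx x) (hw0 x).le
    _ = -(α * β) := by rw [← Finset.sum_mul, hw1, one_mul]
    _ ≤ _ := by linarith [sq_nonneg (α + β)]

/-- If the score vanished along all edges, the logarithmic derivative of the eigenvector would
decrease by `b - Λ'(θ) > 0` along every edge between maximizers of `f`, which is impossible at its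
minimum over the maximizers. -/
lemma deriv2_Lam_pos (hirr : P.IsIrreducible) {f : S → ℝ} {b : ℝ} (hb : ∀ x, f x ≤ b)
    (hmax : MaxSetReachable P f b) {z : S} (hz : f z < b) (θ : ℝ) :
    0 < deriv (deriv (Lam P f)) θ := by
  refine lt_of_le_of_ne (deriv2_Lam_nonneg hirr f θ) fun h0 => ?_
  obtain ⟨w, hw0, hw1, hst⟩ := exists_stationary hirr f θ
  have htw := twist_irreducible hirr f θ
  rw [deriv2_Lam_eq hirr f hw1 hst] at h0
  have hin : ∀ x, 0 ≤ ∑ y, twist P f θ x y * score P f θ x y ^ 2 := fun x =>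
    Finset.sum_nonneg fun y _ => mul_nonneg (htw.nonneg x y) (sq_nonneg _)
  have hscore : ∀ x y, 0 < P x y → score P f θ x y = 0 := by
    intro x y hxy
    have h1 := (Finset.sum_eq_zero_iff_of_nonneg
      fun x _ => mul_nonneg (hw0 x).le (hin x)).1 h0.symm x (Finset.mem_univ x)
    have h2 := (Finset.sum_eq_zero_iff_of_nonneg fun y _ => mul_nonneg (htw.nonneg x y)
      (sq_nonneg _)).1 ((mul_eq_zero.1 h1).resolve_left (hw0 x).ne') y (Finset.mem_univ y)
    have h3 : 0 < twist P f θ x y := mul_pos hxy (Real.exp_pos _)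
    exact pow_eq_zero_iff two_ne_zero |>.1 ((mul_eq_zero.1 h2).resolve_left h3.ne')
  have hlt : deriv (Lam P f) θ < b := by
    rw [deriv_Lam_eq hirr f hw1 hst]
    calc ∑ x, w x * f x < ∑ x, w x * b :=
          Finset.sum_lt_sum (fun x _ => mul_le_mul_of_nonneg_left (hb x) (hw0 x).le)
            ⟨z, Finset.mem_univ z, mul_lt_mul_of_pos_left hz (hw0 z)⟩
      _ = b := by rw [← Finset.sum_mul, hw1, one_mul]
  obtain ⟨y₀, hy₀, -⟩ := hmax.exists_succ z
  have : Nonempty {x // f x = b} := ⟨⟨y₀, hy₀⟩⟩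
  obtain ⟨⟨x, hx⟩, hmin⟩ :=
    Finite.exists_min fun x : {x // f x = b} => deriv (logEigen P f x) θ
  obtain ⟨y, hy, hxy⟩ := hmax.exists_succ x
  have h1 := hscore x y hxy
  have h2 := hmin ⟨y, hy⟩
  simp only [score, hy] at h1
  simp only at h2
  linarith

section Bounds

variable (hP : P ∈ Matrix.rowStochastic ℝ S) (hirr : P.IsIrreducible)
  {f : S → ℝ} {a b : ℝ} (ha : ∀ x, a ≤ f x) (hb : ∀ x, f x ≤ b) (hmax : MaxSetReachable P f b)

include hP hirr ha hb hmax

lemma bddAbove_ratioSet : BddAbove (ratioSet P f) := by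
  obtain ⟨K, hK⟩ := exists_vRatio_le hP hirr ha hb hmax
  refine ⟨K, ?_⟩
  rintro _ ⟨θ, hθ, x, y, rfl⟩
  exact hK θ hθ x y

lemma bddAbove_ratioDerivSet : BddAbove (ratioDerivSet P f) := by
  obtain ⟨K, hK⟩ := exists_vRatio_le hP hirr ha hb hmax
  obtain ⟨C, hC⟩ := exists_logEigen_deriv_sub_le hP hirr ha hb hmax
  refine ⟨K * C, ?_⟩
  rintro _ ⟨θ, hθ, x, y, rfl⟩
  rw [(hasDerivAt_vRatio hirr f x y θ).deriv, abs_mul, abs_of_pos (vRatio_pos hirr f x y θ)]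
  refine mul_le_mul (hK θ hθ x y) (abs_sub_le_iff.2 ⟨hC θ hθ x y, hC θ hθ y x⟩) (abs_nonneg _) ?_
  exact (vRatio_pos hirr f x y θ).le.trans (hK θ hθ x y)

lemma vRatio_le_Ku {θ : ℝ} (hθ : 0 ≤ θ) (x y : S) : vRatio P f x y θ ≤ Ku P f :=
  le_csSup (bddAbove_ratioSet hP hirr ha hb hmax) ⟨θ, hθ, x, y, rfl⟩

lemma one_le_Ku : 1 ≤ Ku P f := by
  have x := Classical.arbitrary S
  rw [← vRatio_self hirr f x 0]
  exact vRatio_le_Ku hP hirr ha hb hmax le_rfl x x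

lemma abs_deriv_logEigen_sub_le {θ : ℝ} (hθ : 0 ≤ θ) (x y : S) :
    |deriv (logEigen P f x) θ - deriv (logEigen P f y) θ| ≤ Ku P f * Lu P f := by
  have h1 : |deriv (vRatio P f x y) θ| ≤ Lu P f :=
    le_csSup (bddAbove_ratioDerivSet hP hirr ha hb hmax) ⟨θ, hθ, x, y, rfl⟩
  have h2 := vRatio_le_Ku hP hirr ha hb hmax hθ y x
  have h3 : deriv (logEigen P f x) θ - deriv (logEigen P f y) θ =
      vRatio P f y x θ * deriv (vRatio P f x y) θ := by
    rw [(hasDerivAt_vRatio hirr f x y θ).deriv, ← mul_assoc, vRatio_mul_swap hirr, one_mul]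
  rw [h3, abs_mul, abs_of_pos (vRatio_pos hirr f y x θ)]
  exact mul_le_mul h2 h1 (abs_nonneg _) (zero_le_one.trans (one_le_Ku hP hirr ha hb hmax))

lemma deriv2_Lam_le {θ : ℝ} (hθ : 0 ≤ θ) :
    deriv (deriv (Lam P f)) θ ≤ (b - a + 2 * Ku P f * Lu P f) ^ 2 / 4 := by
  have h := deriv2_Lam_le_of_score_mem hirr f (θ := θ)
    (α := a - deriv (Lam P f) θ - Ku P f * Lu P f) (β := b - deriv (Lam P f) θ + Ku P f * Lu P f)
    fun x y => by
      have h1 := abs_le.1 (abs_deriv_logEigen_sub_le hP hirr ha hb hmax hθ y x)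
      rw [score]
      constructor
      · linarith [ha y, h1.1]
      · linarith [hb y, h1.2]
  refine h.trans (le_of_eq ?_)
  ring

lemma bddAbove_curvatureSet : BddAbove (curvatureSet P f) := by
  refine ⟨(b - a + 2 * Ku P f * Lu P f) ^ 2 / 4, ?_⟩
  rintro _ ⟨θ, hθ, rfl⟩
  exact deriv2_Lam_le hP hirr ha hb hmax hθ

lemma deriv2_Lam_le_sigmaSq {θ : ℝ} (hθ : 0 ≤ θ) :
    deriv (deriv (Lam P f)) θ ≤ sigmaSq P f :=
  le_csSup (bddAbove_curvatureSet hP hirr ha hb hmax) ⟨θ, hθ, rfl⟩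

lemma sigmaSq_nonneg : 0 ≤ sigmaSq P f :=
  (deriv2_Lam_nonneg hirr f 0).trans (deriv2_Lam_le_sigmaSq hP hirr ha hb hmax le_rfl)

lemma sigmaSq_le : sigmaSq P f ≤ (b - a + 2 * Ku P f * Lu P f) ^ 2 / 4 := by
  refine csSup_le ⟨_, 0, le_rfl, rfl⟩ ?_
  rintro _ ⟨θ, hθ, rfl⟩
  exact deriv2_Lam_le hP hirr ha hb hmax hθ

lemma sigmaSq_pos (hf : ∃ x y : S, f x ≠ f y) : 0 < sigmaSq P f := by
  have hz : ∃ z, f z < b := by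
    obtain ⟨x, y, hxy⟩ := hf
    by_contra! h
    exact hxy ((le_antisymm (hb x) (h x)).trans (le_antisymm (hb y) (h y)).symm)
  obtain ⟨z, hz⟩ := hz
  exact (deriv2_Lam_pos hirr hb hmax hz 0).trans_le
    (deriv2_Lam_le_sigmaSq hP hirr ha hb hmax le_rfl)

end Bounds

/-- Tilting by a constant does not change the right eigenvector. -/
lemma vRatio_eq_one_of_const (hP : P ∈ Matrix.rowStochastic ℝ S) (hirr : P.IsIrreducible)
    {f : S → ℝ} {c : ℝ} (hf : ∀ x, f x = c) (x y : S) (θ : ℝ) : vRatio P f x y θ = 1 := by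
  have hi := tilt_irreducible hirr f θ
  have hcard : (Fintype.card S : ℝ) ≠ 0 := by exact_mod_cast Fintype.card_ne_zero
  have h := (perron_unique hi (r := Real.exp (θ * c)) (v := fun _ => (Fintype.card S : ℝ)⁻¹)
    (Real.exp_pos _).le (fun _ => by positivity) (by simp [hcard]) ?_).2
  · rw [vRatio, perronRight_div hi, h]
    exact div_self (inv_ne_zero hcard)
  · funext x
    simp only [mulVec_apply_eq, tilt, Matrix.of_apply, hf, ← Finset.sum_mul,
      Matrix.sum_row_of_mem_rowStochastic hP, Pi.smul_apply, smul_eq_mul, one_mul]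

lemma Lu_eq_zero_of_const (hP : P ∈ Matrix.rowStochastic ℝ S) (hirr : P.IsIrreducible)
    {f : S → ℝ} {c : ℝ} (hf : ∀ x, f x = c) : Lu P f = 0 := by
  have h : ratioDerivSet P f = {0} := by
    ext r
    have h1 : ∀ x y θ, deriv (vRatio P f x y) θ = 0 := fun x y θ => by
      rw [funext (vRatio_eq_one_of_const hP hirr hf x y), deriv_const]
    simp [ratioDerivSet, h1]
    exact fun _ => ⟨0, le_rfl⟩
  rw [Lu, h, csSup_singleton]

omit [Fintype S] [DecidableEq S] [Nonempty S] in
lemma tilt_zero (P : Matrix S S ℝ) (f : S → ℝ) : tilt P f 0 = P := by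
  ext x y; simp [tilt]

lemma Lam_zero (hP : P ∈ Matrix.rowStochastic ℝ S) (f : S → ℝ) : Lam P f 0 = 0 := by
  rw [Lam, tilt_zero, specRad_eq_of_pos_eigenvector
    (fun x y => Matrix.nonneg_of_mem_rowStochastic hP) zero_le_one (v := fun _ => 1)
    (fun _ => one_pos), Real.log_one]
  rw [one_smul]
  exact Matrix.one_vecMul_of_mem_rowStochastic hP

lemma vRatio_zero (hP : P ∈ Matrix.rowStochastic ℝ S) (hirr : P.IsIrreducible) (f : S → ℝ)
    (x y : S) : vRatio P f x y 0 = 1 := by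
  rw [← vRatio_eq_one_of_const hP hirr (f := fun _ => 0) (fun _ => rfl) x y 0, vRatio, vRatio,
    tilt_zero, tilt_zero]

lemma twist_zero (hP : P ∈ Matrix.rowStochastic ℝ S) (hirr : P.IsIrreducible) (f : S → ℝ) :
    twist P f 0 = P := by
  ext x y
  have h : specRad P = 1 := by
    have h1 := specRad_tilt_pos hirr f 0
    have h2 := Lam_zero hP f
    rw [Lam, tilt_zero] at h2
    rw [tilt_zero] at h1
    exact Real.eq_one_of_pos_of_log_eq_zero h1 h2
  rw [twist_eq hirr, vRatio_zero hP hirr, tilt_zero, h, mul_one, div_one]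

lemma deriv_Lam_zero (hP : P ∈ Matrix.rowStochastic ℝ S) (hirr : P.IsIrreducible) {π : S → ℝ}
    (hπ : π ∈ stdSimplex ℝ S) (hstat : Matrix.vecMul π P = π) (f : S → ℝ) :
    deriv (Lam P f) 0 = ∑ x, π x * f x := by
  refine deriv_Lam_eq hirr f hπ.2 fun y => ?_
  rw [twist_zero hP hirr]
  exact congrFun hstat y

/-- Second-order Taylor bound for `Λ` on the half-line. -/
lemma Lam_le_of_deriv2_le (hP : P ∈ Matrix.rowStochastic ℝ S) (hirr : P.IsIrreducible)
    (f : S → ℝ) {v : ℝ} (hv : ∀ θ, 0 ≤ θ → deriv (deriv (Lam P f)) θ ≤ v) {θ : ℝ} (hθ : 0 ≤ θ) :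
    Lam P f θ ≤ θ * deriv (Lam P f) 0 + v * θ ^ 2 / 2 := by
  set m := deriv (Lam P f) 0
  have hd1 : ∀ t, HasDerivAt (fun t => m + v * t - deriv (Lam P f) t)
      (v - deriv (deriv (Lam P f)) t) t := fun t => by
    refine ((((hasDerivAt_id t).const_mul v).const_add m).sub
      (hasDerivAt_deriv_Lam hirr f t)).congr_deriv ?_
    simp
  have hd0 : ∀ t, HasDerivAt (fun t => t * m + v * t ^ 2 / 2 - Lam P f t)
      (m + v * t - deriv (Lam P f) t) t := fun t => by
    refine ((((hasDerivAt_id t).mul_const m).add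
      ((((hasDerivAt_id t).pow 2).const_mul v).div_const 2)).sub
      (hasDerivAt_Lam hirr f t)).congr_deriv ?_
    simp
    ring
  have mono1 : MonotoneOn (fun t => m + v * t - deriv (Lam P f) t) (Set.Ici 0) :=
    monotoneOn_of_hasDerivWithinAt_nonneg (convex_Ici 0)
      (fun t _ => (hd1 t).continuousAt.continuousWithinAt)
      (fun t _ => (hd1 t).hasDerivWithinAt) fun t ht => by
        rw [interior_Ici] at ht
        exact sub_nonneg.2 (hv t (le_of_lt ht))
  have mono0 : MonotoneOn (fun t => t * m + v * t ^ 2 / 2 - Lam P f t) (Set.Ici 0) :=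
    monotoneOn_of_hasDerivWithinAt_nonneg (convex_Ici 0)
      (fun t _ => (hd0 t).continuousAt.continuousWithinAt)
      (fun t _ => (hd0 t).hasDerivWithinAt) fun t ht => by
        rw [interior_Ici] at ht
        have ht : (0 : ℝ) < t := ht
        have := mono1 (Set.mem_Ici.2 le_rfl) (Set.mem_Ici.2 ht.le) ht.le
        simpa [m] using this
  have := mono0 (Set.mem_Ici.2 le_rfl) (Set.mem_Ici.2 hθ) hθ
  simp only [Lam_zero hP] at this
  linarith

end Constants

/-! ### Exponential moments of the chain -/

section Chernoff

variable {S : Type*} [Fintype S]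

/-- The total `M`-weight of all paths of length `n` started from `q` and ended with an eigenvector
of `M`. -/
lemma sum_path_weight {M : Matrix S S ℝ} {v : S → ℝ} {r : ℝ} (h : M.mulVec v = r • v) (n : ℕ)
    (q : S → ℝ) :
    ∑ x : Fin (n + 1) → S, q (x 0) * (∏ k : Fin n, M (x k.castSucc) (x k.succ)) *
      v (x (Fin.last n)) = r ^ n * ∑ s, q s * v s := by
  induction n generalizing q with
  | zero =>
    simp only [Finset.univ_eq_empty, Finset.prod_empty, mul_one, pow_zero, one_mul]
    exact Fintype.sum_equiv (Equiv.funUnique (Fin 1) S) _ _ fun x => rfl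
  | succ n ih =>
    have hq : ∑ s, Matrix.vecMul q M s * v s = r * ∑ s, q s * v s := by
      have := Matrix.dotProduct_mulVec q M v
      rw [h, dotProduct_smul] at this
      exact this.symm
    rw [pow_succ, mul_assoc, ← hq, ← ih, ← (Fin.consEquiv fun _ => S).sum_comp,
      Fintype.sum_prod_type, Finset.sum_comm]
    refine Finset.sum_congr rfl fun x _ => ?_
    have h1 : Matrix.vecMul q M (x 0) = ∑ s, q s * M s (x 0) := rfl
    rw [h1, Finset.sum_mul, Finset.sum_mul]
    refine Finset.sum_congr rfl fun s _ => ?_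
    rw [Fin.prod_univ_succ]
    simp only [Fin.consEquiv_apply, Fin.cons_zero, Fin.castSucc_zero, Fin.cons_succ,
      ← Fin.succ_castSucc, ← Fin.succ_last]
    ring

variable [DecidableEq S] [Nonempty S] {P : Matrix S S ℝ}

/-- The Chernoff bound for an additive functional at a fixed parameter `θ`. The indicator of
each cylinder is dominated by its exponential weight, and the constant function by the
eigenvector. -/
lemma chernoff (hirr : P.IsIrreducible) (f : S → ℝ) {θ K : ℝ} (hθ : 0 ≤ θ)
    (hK : ∀ x y, vRatio P f x y θ ≤ K) {q : S → ℝ} (hq : q ∈ stdSimplex ℝ S)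
    {Ω : Type*} [MeasurableSpace Ω] (ℙ : Measure Ω) [IsProbabilityMeasure ℙ] {X : ℕ → Ω → S}
    (hX : IsMarkovChain ℙ q P X) {n : ℕ} (hn : 1 ≤ n) (μ : ℝ) :
    ℙ.real {ω | μ ≤ (n : ℝ)⁻¹ * ∑ k ∈ Finset.Icc 1 n, f (X k ω)} ≤
      K * Real.exp (n * (Lam P f θ - θ * μ)) := by
  classical
  have hi := tilt_irreducible hirr f θ
  obtain ⟨m, hm⟩ := Finite.exists_min (perronRight (tilt P f θ))
  set v : S → ℝ := fun x => vRatio P f x m θ with hv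
  have hv1 : ∀ x, 1 ≤ v x := fun x => (one_le_div₀ ((perronRight_spec hi).1 m)).2 (hm x)
  have hvM : (tilt P f θ).mulVec v = specRad (tilt P f θ) • v := by
    have h : v = (perronRight (tilt P f θ) m)⁻¹ • perronRight (tilt P f θ) := by
      funext x; simp [hv, vRatio, div_eq_inv_mul]
    rw [h, Matrix.mulVec_smul, (perronRight_spec hi).2, smul_comm]
  -- A path on `{0, …, n}` is extended to `ℕ` by its last value.
  let pad : (Fin (n + 1) → S) → ℕ → S := fun x k => x ⟨min k n, by omega⟩
  have hsum : ∀ g : ℕ → ℝ, ∑ k ∈ Finset.Icc 1 n, g k = ∑ k ∈ Finset.range n, g (k + 1) := by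
    intro g
    rw [Finset.range_eq_Ico, Finset.sum_Ico_add' g 0 n 1]
    rfl
  set G : Finset (Fin (n + 1) → S) :=
    Finset.univ.filter fun x => μ ≤ (n : ℝ)⁻¹ * ∑ k ∈ Finset.Icc 1 n, f (pad x k) with hG
  have hcover : {ω | μ ≤ (n : ℝ)⁻¹ * ∑ k ∈ Finset.Icc 1 n, f (X k ω)} ⊆
      ⋃ x ∈ G, {ω | ∀ k ≤ n, X k ω = pad x k} := by
    intro ω hω
    have hpad : ∀ k ≤ n, X k ω = pad (fun j : Fin (n + 1) => X j ω) k := fun k hk => by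
      simp [pad, min_eq_left hk]
    refine Set.mem_biUnion (x := fun j : Fin (n + 1) => X j ω) ?_ hpad
    simp only [hG, Finset.coe_filter, Finset.mem_univ, true_and, Set.mem_ofPred_eq]
    rw [← Finset.sum_congr rfl fun k hk => congrArg f (hpad k (Finset.mem_Icc.1 hk).2)]
    exact hω
  have hn0 : (0 : ℝ) < n := by exact_mod_cast hn
  have hterm : ∀ x ∈ G, ℙ.real {ω | ∀ k ≤ n, X k ω = pad x k} ≤
      Real.exp (-(n * (θ * μ))) * (q (x 0) *
        (∏ k : Fin n, tilt P f θ (x k.castSucc) (x k.succ)) * v (x (Fin.last n))) := by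
    intro x hx
    have h1 : (n : ℝ) * μ ≤ ∑ k ∈ Finset.range n, f (pad x (k + 1)) := by
      have := (Finset.mem_filter.1 hx).2
      rwa [inv_mul_eq_div, le_div_iff₀ hn0, mul_comm, hsum] at this
    have h2 : ∏ k : Fin n, tilt P f θ (x k.castSucc) (x k.succ) =
        (∏ k ∈ Finset.range n, P (pad x k) (pad x (k + 1))) *
          Real.exp (θ * ∑ k ∈ Finset.range n, f (pad x (k + 1))) := by
      rw [Finset.mul_sum, Real.exp_sum, ← Finset.prod_mul_distrib, Finset.prod_range]
      refine Finset.prod_congr rfl fun k _ => ?_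
      have h3 : pad x k = x k.castSucc :=
        congrArg x (Fin.ext (by simp [k.2.le]))
      have h4 : pad x (k + 1) = x k.succ :=
        congrArg x (Fin.ext (by simp))
      rw [h3, h4]
      rfl
    have h5 : pad x 0 = x 0 := congrArg x (Fin.ext (by simp))
    rw [hX.law, h2, h5]
    have hnn : 0 ≤ q (x 0) * ∏ k ∈ Finset.range n, P (pad x k) (pad x (k + 1)) :=
      mul_nonneg (hq.1 _) (Finset.prod_nonneg fun k _ => hirr.nonneg _ _)
    have h6 : 1 ≤ Real.exp (-(n * (θ * μ))) *
        Real.exp (θ * ∑ k ∈ Finset.range n, f (pad x (k + 1))) * v (x (Fin.last n)) := by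
      refine one_le_mul_of_one_le_of_one_le ?_ (hv1 _)
      rw [← Real.exp_add]
      refine Real.one_le_exp ?_
      linarith [mul_le_mul_of_nonneg_left h1 hθ]
    calc _ ≤ _ := le_mul_of_one_le_right hnn h6
      _ = _ := by ring
  calc _ ≤ ℙ.real (⋃ x ∈ G, {ω | ∀ k ≤ n, X k ω = pad x k}) :=
        measureReal_mono hcover (measure_ne_top _ _)
    _ ≤ ∑ x ∈ G, ℙ.real {ω | ∀ k ≤ n, X k ω = pad x k} := measureReal_biUnion_finset_le _ _
    _ ≤ ∑ x ∈ G, Real.exp (-(n * (θ * μ))) * (q (x 0) *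
          (∏ k : Fin n, tilt P f θ (x k.castSucc) (x k.succ)) * v (x (Fin.last n))) :=
        Finset.sum_le_sum hterm
    _ ≤ ∑ x : Fin (n + 1) → S, Real.exp (-(n * (θ * μ))) * (q (x 0) *
          (∏ k : Fin n, tilt P f θ (x k.castSucc) (x k.succ)) * v (x (Fin.last n))) :=
        Finset.sum_le_sum_of_subset_of_nonneg (Finset.subset_univ _) fun x _ _ =>
          mul_nonneg (Real.exp_pos _).le (mul_nonneg (mul_nonneg (hq.1 _)
            (Finset.prod_nonneg fun k _ => hi.nonneg _ _)) (zero_le_one.trans (hv1 _)))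
    _ = Real.exp (-(n * (θ * μ))) * (specRad (tilt P f θ) ^ n * ∑ s, q s * v s) := by
        rw [← Finset.mul_sum, sum_path_weight hvM]
    _ ≤ Real.exp (-(n * (θ * μ))) * (specRad (tilt P f θ) ^ n * K) := by
        have h7 : ∑ s, q s * v s ≤ K :=
          calc _ ≤ ∑ s, q s * K :=
                Finset.sum_le_sum fun s _ => mul_le_mul_of_nonneg_left (hK s m) (hq.1 s)
            _ = K := by rw [← Finset.sum_mul, hq.2, one_mul]
        exact mul_le_mul_of_nonneg_left (mul_le_mul_of_nonneg_left h7
          (pow_nonneg (specRad_tilt_pos hirr f θ).le n)) (Real.exp_pos _).le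
    _ = _ := by
        have h8 : specRad (tilt P f θ) ^ n = Real.exp (n * Lam P f θ) := by
          rw [Real.exp_nat_mul, Lam, Real.exp_log (specRad_tilt_pos hirr f θ)]
        rw [h8, mul_comm K, ← mul_assoc, ← Real.exp_add]
        congr 2
        ring

end Chernoff

end TiltedChain

/-! ### The tail bound -/

theorem theorem2 {S : Type*} [Fintype S] [DecidableEq S]
    (P : Matrix S S ℝ) (hP : P ∈ Matrix.rowStochastic ℝ S) (hirr : P.IsIrreducible)
    (π : S → ℝ) (hπ : π ∈ stdSimplex ℝ S) (hstat : Matrix.vecMul π P = π)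
    (f : S → ℝ) (a b : ℝ)
    (ha : IsLeast (Set.range f) a) (hb : IsGreatest (Set.range f) b)
    (h1 : (P.submatrix (fun x : {x : S // f x = b} => (x : S))
      (fun x : {x : S // f x = b} => (x : S))).IsIrreducible)
    (h2 : ∀ x : S, f x ≠ b → ∃ y : S, f y = b ∧ 0 < P x y) :
    -- the quantities in the bounds are well defined and finite
    ContDiff ℝ 2 (TiltedChain.Lam P f) ∧
    (∀ x y : S, Differentiable ℝ (TiltedChain.vRatio P f x y)) ∧
    BddAbove (TiltedChain.ratioSet P f) ∧
    BddAbove (TiltedChain.ratioDerivSet P f) ∧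
    BddAbove (TiltedChain.curvatureSet P f) ∧
    ((∃ x y : S, f x ≠ f y) → 0 < TiltedChain.sigmaSq P f) ∧
    -- the tail bounds
    ∀ (q : S → ℝ), q ∈ stdSimplex ℝ S →
      ∀ {Ω : Type*} [MeasurableSpace Ω] (ℙ : MeasureTheory.Measure Ω)
        [MeasureTheory.IsProbabilityMeasure ℙ] (X : ℕ → Ω → S),
        TiltedChain.IsMarkovChain ℙ q P X →
        ∀ (n : ℕ), 1 ≤ n → ∀ (μ : ℝ), ∑ x, π x * f x ≤ μ →
          ℙ.real {ω | μ ≤ (n : ℝ)⁻¹ * ∑ k ∈ Finset.Icc 1 n, f (X k ω)}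
              ≤ TiltedChain.Ku P f *
                  Real.exp (-(n * ((μ - ∑ x, π x * f x) ^ 2 / (2 * TiltedChain.sigmaSq P f)))) ∧
          TiltedChain.Ku P f *
                Real.exp (-(n * ((μ - ∑ x, π x * f x) ^ 2 / (2 * TiltedChain.sigmaSq P f))))
              ≤ TiltedChain.Ku P f *
                  Real.exp (-(n * (2 * (μ - ∑ x, π x * f x) ^ 2 /
                    (b - a + 2 * TiltedChain.Ku P f * TiltedChain.Lu P f) ^ 2))) := by
  have : Nonempty S := ha.1.nonempty
  have ha' : ∀ x, a ≤ f x := fun x => ha.2 ⟨x, rfl⟩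
  have hb' : ∀ x, f x ≤ b := fun x => hb.2 ⟨x, rfl⟩
  have hmax : TiltedChain.MaxSetReachable P f b := ⟨h1, h2⟩
  have hK1 := TiltedChain.one_le_Ku hP hirr ha' hb' hmax
  have hσ0 := TiltedChain.sigmaSq_nonneg hP hirr ha' hb' hmax
  refine ⟨(TiltedChain.contDiff_tilt_perron hirr f).1,
    fun x y θ => (TiltedChain.hasDerivAt_vRatio hirr f x y θ).differentiableAt,
    TiltedChain.bddAbove_ratioSet hP hirr ha' hb' hmax,
    TiltedChain.bddAbove_ratioDerivSet hP hirr ha' hb' hmax,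
    TiltedChain.bddAbove_curvatureSet hP hirr ha' hb' hmax,
    TiltedChain.sigmaSq_pos hP hirr ha' hb' hmax, ?_⟩
  intro q hq Ω _ ℙ _ X hX n hn μ hμ
  set d := μ - ∑ x, π x * f x with hd
  have hd0 : 0 ≤ d := sub_nonneg.2 hμ
  constructor
  · -- The minimizer of `θ ↦ σ² θ² / 2 - θ d`; it is `0` if `σ² = 0`.
    set θ := d / TiltedChain.sigmaSq P f with hθ
    have hθ0 : 0 ≤ θ := div_nonneg hd0 hσ0
    refine (TiltedChain.chernoff hirr f hθ0
      (TiltedChain.vRatio_le_Ku hP hirr ha' hb' hmax hθ0) hq ℙ hX hn μ).trans ?_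
    refine mul_le_mul_of_nonneg_left (Real.exp_le_exp.2 ?_) (zero_le_one.trans hK1)
    rw [← mul_neg]
    refine mul_le_mul_of_nonneg_left ?_ (Nat.cast_nonneg n)
    have hL := TiltedChain.Lam_le_of_deriv2_le hP hirr f
      (fun θ hθ => TiltedChain.deriv2_Lam_le_sigmaSq hP hirr ha' hb' hmax hθ) hθ0
    rw [TiltedChain.deriv_Lam_zero hP hirr hπ hstat f] at hL
    have hopt : TiltedChain.sigmaSq P f * θ ^ 2 / 2 - θ * d =
        -(d ^ 2 / (2 * TiltedChain.sigmaSq P f)) := by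
      rcases hσ0.eq_or_lt with h0 | h0
      · simp [hθ, ← h0]
      · rw [hθ]; field_simp; ring
    rw [← hopt, hd]
    linarith
  · refine mul_le_mul_of_nonneg_left (Real.exp_le_exp.2 (neg_le_neg
      (mul_le_mul_of_nonneg_left ?_ (Nat.cast_nonneg n)))) (zero_le_one.trans hK1)
    by_cases hf : ∃ x y : S, f x ≠ f y
    · have hσ := TiltedChain.sigmaSq_pos hP hirr ha' hb' hmax hf
      have hle := TiltedChain.sigmaSq_le hP hirr ha' hb' hmax
      rw [div_le_div_iff₀ (by linarith) (by positivity)]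
      linarith [mul_le_mul_of_nonneg_left hle (sq_nonneg d)]
    · -- If `f` is constant then `b - a + 2 K L = 0`.
      push Not at hf
      have x := Classical.arbitrary S
      have hab : a = b := by
        obtain ⟨y, hy⟩ := ha.1
        obtain ⟨z, hz⟩ := hb.1
        rw [← hy, ← hz, hf y z]
      rw [TiltedChain.Lu_eq_zero_of_const hP hirr fun y => hf y x, hab]
      simp only [sub_self, mul_zero, add_zero, ne_eq, OfNat.ofNat_ne_zero, not_false_eq_true,
        zero_pow, div_zero]
      positivity
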